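/- A function $f:\mathbb{R}^d\to[0,\infty)$ is log-concave if $f=e^{-V}$ with $V:\mathbb{R}^d\to\mathbb{R}\cup\{+\infty\}$ convex. It is a density if $\int_{\mathbb{R}^d} f=1$, centered if $\int_{\mathbb{R}^d} x f(x)\,dx=0$, and isotropic if its covariance matrix, with entries $$\frac{\int x_ix_jf(x)\,dx}{\int f(x)\,dx}-\frac{\int x_if(x)\,dx\int x_jf(x)\,dx}{\left(\int f(x)\,dx\right)^2},$$ equals $\sigma^2 I_d$ for some $\sigma>0$. (i) For every $d\ge 1$ there is a constant $C_d$, depending only on $d$ (in particular not on $f$ or $\sigma$), such that for every centered, isotropic, log-concave density $f$ on $\mathbb{R}^d$ and every $1\le i\le d$, the function $x_if(x)$ is integrable, the series $\sum_{k\in\mathbb{Z}^d}k_if(k)$ converges absolutely, and $$\Bigl|\sum_{k\in\mathbb{Z}^d}k_if(k)-\int_{\mathbb{R}^d}x_if(x)\,dx\Bigr|\le C_d,\qquad \Bigl|\sum_{k\in\mathbb{Z}^d}k_if(k)\Bigr|\le C_d .$$ (ii) For every integrable log-concave function $f:\mathbb{R}\to[0,\infty)$ with $\int_{\mathbb{R}}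 f>0$ and $\int_{\mathbb{R}}xf(x)\,dx=0$, the function $xf(x)$ is integrable, the series $\sum_{k\in\mathbb{Z}}f(k)$ and $\sum_{k\in\mathbb{Z}}kf(k)$ converge absolutely, and $$\Bigl|\int_{\mathbb{R}}xf(x)\,dx-\sum_{k\in\mathbb{Z}}kf(k)\Bigr|\le (e+1)\sum_{k\in\mathbb{Z}}f(k).$$ -/

import Mathlib

open MeasureTheory

noncomputable section

/-- `f = exp (-V)` for a convex `V : E → ℝ ∪ {+∞}`, written multiplicatively: `f` is nonnegative
and `f (a x + b y) ≥ f(x)^a f(y)^b` for all weights `a, b > 0` with `a + b = 1`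
(where `0 ^ a = 0` since `a > 0`). -/
def IsLogConcave {E : Type*} [AddCommGroup E] [Module ℝ E] (f : E → ℝ) : Prop :=
  (∀ x, 0 ≤ f x) ∧
    ∀ (x y : E) (a b : ℝ), 0 < a → 0 < b → a + b = 1 →
      f x ^ a * f y ^ b ≤ f (a • x + b • y)

/-- A probability density on `ℝ^d`. -/
def IsDensity {d : ℕ} (f : (Fin d → ℝ) → ℝ) : Prop :=
  (∀ x, 0 ≤ f x) ∧ Integrable f ∧ ∫ x, f x = 1

/-- `f` has its barycenter at the origin. -/
def IsCentered {d : ℕ} (f : (Fin d → ℝ) → ℝ) : Prop :=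
  ∀ i, ∫ x, x i * f x = 0

/-- The covariance matrix of a nonnegative function on `ℝ^d`. -/
def covMatrix {d : ℕ} (f : (Fin d → ℝ) → ℝ) : Matrix (Fin d) (Fin d) ℝ :=
  Matrix.of fun i j =>
    (∫ x, x i * x j * f x) / (∫ x, f x)
      - (∫ x, x i * f x) * (∫ x, x j * f x) / (∫ x, f x) ^ 2

/-- The covariance matrix is a positive multiple of the identity. -/
def IsIsotropic {d : ℕ} (f : (Fin d → ℝ) → ℝ) : Prop :=
  ∃ σ : ℝ, 0 < σ ∧ covMatrix f = σ ^ 2 • (1 : Matrix (Fin d) (Fin d) ℝ)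

/-- A point of the lattice `ℤ^d` as a point of `ℝ^d`. -/
def latticePoint {d : ℕ} (k : Fin d → ℤ) : Fin d → ℝ := fun j => (k j : ℝ)

end

/-! Part (i) rests on a uniform shape theorem. Choose a point `x₀` where `f` is within a factor `e`
of its supremum, and among the matrices whose columns `v` satisfy `f (x₀ + v) ≥ f x₀ / e` choose `T`
with almost maximal `|det|`. By Cramer's rule the level set `{f ≥ f x₀ / e}` is then bounded in the
coordinates `x = x₀ + T y`, and log-concavity turns this into exponential decay in `‖y‖`
(`exists_affine_normalization`). Isotropy bounds the entries of `T` and `T⁻¹` by multiples of `σ`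
and `σ⁻¹`, so up to constants depending on `d` the density is of size `m` on a ball of radius `r *
σ`, decays at scale `σ`, and has `m * σ ^ d ≤ A` (`exists_isotropic_bounds`).

For large `σ` the lattice sum is the integral of a step function. A homothety of ratio `1 - ε` or
its inverse, with `ε = 1 / (r σ)`, absorbs the rounding displacement at the price of a factor `exp
(2 ε)` in `f`. The relative error is `O(ε)` and the first moments are `O(σ)`, so the absolute error
is `O(1)`. This is applied to the positive and negative parts of `x i`, whose integrals cancel. For
small `σ` only terms with `‖k‖ ≥ 1` matter, and there the decay `exp (-c ‖k‖ / σ)` beats the height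
`σ ^ (-d)`.

For part (ii), a centered log-concave `f` satisfies `f ≤ e f(0)`, by comparison with an exponential.
After a reflection `f` increases up to some `n ≥ 0` and decreases from `n + 1`. Comparing `x f(x)`
with its values on unit cells costs one copy of `∑ f(k)` for the shift and at most `(n + 1) e f(0)`
near the mode; the latter is at most `e ∑ f(k)` because `f ≥ f(0)` at `0, …, n`. -/

/-! ### Log-concavity and affine changes of variables -/

/-- Concavity of `log (f / m)`, phrased through lower bounds so that zeros of `f` need no
convention, and with the end weights `p = 0, 1` included. -/
theorem IsLogConcave.mul_exp_le {E : Type*} [AddCommGroup E] [Module ℝ E] {f : E → ℝ}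
    (hf : IsLogConcave f) {x y : E} {m s t p : ℝ} (hm : 0 < m) (hp0 : 0 ≤ p) (hp1 : p ≤ 1)
    (hx : m * Real.exp s ≤ f x) (hy : m * Real.exp t ≤ f y) :
    m * Real.exp ((1 - p) * s + p * t) ≤ f ((1 - p) • x + p • y) := by
  rcases hp0.eq_or_lt with rfl | hp0
  · simpa using hx
  rcases hp1.eq_or_lt with rfl | hp1
  · simpa using hy
  refine le_trans ?_ (hf.2 x y (1 - p) p (by linarith) hp0 (by ring))
  have h1 : (m * Real.exp s) ^ (1 - p) ≤ f x ^ (1 - p) :=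
    Real.rpow_le_rpow (by positivity) hx (by linarith)
  have h2 : (m * Real.exp t) ^ p ≤ f y ^ p := Real.rpow_le_rpow (by positivity) hy hp0.le
  refine le_trans (le_of_eq ?_) (mul_le_mul h1 h2 (by positivity) (Real.rpow_nonneg (hf.1 x) _))
  rw [Real.mul_rpow hm.le (Real.exp_pos _).le, Real.mul_rpow hm.le (Real.exp_pos _).le,
    ← Real.exp_mul, ← Real.exp_mul, mul_mul_mul_comm, ← Real.rpow_add hm, ← Real.exp_add]
  congr 1
  · simp
  · ring_nf

theorem IsLogConcave.convex_ge {E : Type*} [AddCommGroup E] [Module ℝ E] {f : E → ℝ}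
    (hf : IsLogConcave f) (a : ℝ) : Convex ℝ {x | a ≤ f x} := by
  rcases le_or_gt a 0 with ha | ha
  · convert convex_univ
    ext x
    simpa using ha.trans (hf.1 x)
  rw [convex_iff_forall_pos]
  intro x hx y hy p q hp hq hpq
  obtain rfl : p = 1 - q := by linarith
  have := hf.mul_exp_le (s := 0) (t := 0) (x := x) (y := y) ha hq.le (by linarith)
    (by simpa using hx) (by simpa using hy)
  simpa using this

/-- Points of the box have nonnegative coordinates with sum at most `1`, so `x₀ + T y` lies in the
simplex with vertices `x₀` and `x₀ + T.col j`, on which superlevel sets are convex. -/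
theorem IsLogConcave.le_of_mem_box {d : ℕ} {f : (Fin d → ℝ) → ℝ} (hf : IsLogConcave f)
    {a : ℝ} {x₀ : Fin d → ℝ} {T : Matrix (Fin d) (Fin d) ℝ} (h0 : a ≤ f x₀)
    (hT : ∀ j, a ≤ f (x₀ + T.col j)) {y : Fin d → ℝ}
    (hy : y ∈ Set.Icc (0 : Fin d → ℝ) fun _ => (d : ℝ)⁻¹) : a ≤ f (x₀ + T.mulVec y) := by
  have hsum : ∑ j, y j ≤ 1 := by
    calc ∑ j, y j ≤ ∑ _j : Fin d, (d : ℝ)⁻¹ := Finset.sum_le_sum fun j _ => hy.2 j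
      _ ≤ 1 := by
        simp only [Finset.sum_const, Finset.card_univ, Fintype.card_fin, nsmul_eq_mul]
        exact mul_inv_le_one
  have := (hf.convex_ge a).sum_mem (t := Finset.univ)
    (w := fun o : Option (Fin d) => o.elim (1 - ∑ j, y j) y)
    (z := fun o => o.elim x₀ fun j => x₀ + T.col j) ?_ ?_ ?_
  · have h2 : ∑ o : Option (Fin d), (o.elim (1 - ∑ j, y j) y) •
        (o.elim x₀ fun j => x₀ + T.col j : Fin d → ℝ) = x₀ + T.mulVec y := by
      ext i
      simp [Fintype.sum_option, Matrix.mulVec, dotProduct, Finset.sum_add_distrib, mul_add,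
        mul_comm]
      simp only [mul_sub, Finset.mul_sum]
      ring
    rw [h2] at this
    exact this
  · rintro (_ | j) -
    · simpa using hsum
    · exact hy.1 j
  · simp [Fintype.sum_option]
  · rintro (_ | j) -
    · exact h0
    · exact hT j

theorem map_add_mulVec_volume {d : ℕ} (x₀ : Fin d → ℝ) {T : Matrix (Fin d) (Fin d) ℝ}
    (hT : T.det ≠ 0) :
    Measure.map (fun y => x₀ + T.mulVec y) volume = ENNReal.ofReal |T.det⁻¹| • volume := by
  have h1 : (fun y => x₀ + T.mulVec y) = (fun z => x₀ + z) ∘ (Matrix.toLin' T) := by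
    ext; simp
  rw [h1, ← Measure.map_map (by fun_prop) (LinearMap.continuous_of_finiteDimensional _).measurable,
    Real.map_matrix_volume_pi_eq_smul_volume_pi hT, Measure.map_smul, map_add_left_eq_self]

theorem measurableEmbedding_add_mulVec {d : ℕ} (x₀ : Fin d → ℝ) {T : Matrix (Fin d) (Fin d) ℝ}
    (hT : T.det ≠ 0) : MeasurableEmbedding (fun y => x₀ + T.mulVec y) := by
  have hc : Continuous (fun y => x₀ + T.mulVec y) := by fun_prop
  refine hc.measurableEmbedding ?_
  intro y z hyz
  exact Matrix.mulVec_injective_of_isUnit ((Matrix.isUnit_iff_isUnit_det _).2 hT.isUnit)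
    (add_left_cancel hyz)

theorem integral_comp_add_mulVec {d : ℕ} (x₀ : Fin d → ℝ) {T : Matrix (Fin d) (Fin d) ℝ}
    (hT : T.det ≠ 0) (F : (Fin d → ℝ) → ℝ) :
    |T.det| * ∫ y, F (x₀ + T.mulVec y) = ∫ x, F x := by
  have h := (measurableEmbedding_add_mulVec x₀ hT).integral_map (μ := volume) F
  rw [← h, map_add_mulVec_volume x₀ hT, integral_smul_measure, ENNReal.toReal_ofReal (abs_nonneg _),
    smul_eq_mul, ← mul_assoc, ← abs_mul, mul_inv_cancel₀ hT, abs_one, one_mul]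

theorem integrable_comp_add_mulVec {d : ℕ} (x₀ : Fin d → ℝ) {T : Matrix (Fin d) (Fin d) ℝ}
    (hT : T.det ≠ 0) {F : (Fin d → ℝ) → ℝ} :
    Integrable (fun y => F (x₀ + T.mulVec y)) ↔ Integrable F := by
  have h := (measurableEmbedding_add_mulVec x₀ hT).integrable_map_iff (μ := volume) (g := F)
  rw [map_add_mulVec_volume x₀ hT, integrable_smul_measure (by simpa using hT) (by simp)] at h
  exact h.symm

theorem volume_real_box {d : ℕ} {h : ℝ} (hh : 0 ≤ h) :
    volume.real (Set.Icc (0 : Fin d → ℝ) fun _ => h) = h ^ d := by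
  simp [Measure.real, Real.volume_Icc_pi, hh]

theorem mul_pow_mul_abs_det_le_integral {d : ℕ} {f : (Fin d → ℝ) → ℝ} (hf : ∀ x, 0 ≤ f x)
    (hi : Integrable f) {a h : ℝ} (hh : 0 ≤ h) {x₀ : Fin d → ℝ} {T : Matrix (Fin d) (Fin d) ℝ}
    (hb : ∀ y ∈ Set.Icc (0 : Fin d → ℝ) (fun _ => h), a ≤ f (x₀ + T.mulVec y)) :
    a * h ^ d * |T.det| ≤ ∫ x, f x := by
  by_cases hT : T.det = 0
  · simpa [hT] using integral_nonneg hf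
  rw [← integral_comp_add_mulVec x₀ hT, mul_comm]
  gcongr
  have hi' := (integrable_comp_add_mulVec x₀ hT).2 hi
  calc a * h ^ d = ∫ _y in Set.Icc (0 : Fin d → ℝ) (fun _ => h), a := by
        rw [setIntegral_const, volume_real_box hh, smul_eq_mul, mul_comm]
    _ ≤ ∫ y in Set.Icc (0 : Fin d → ℝ) (fun _ => h), f (x₀ + T.mulVec y) :=
        setIntegral_mono_on (integrableOn_const (by simp [Real.volume_Icc_pi]))
          hi'.integrableOn measurableSet_Icc hb
    _ ≤ ∫ y, f (x₀ + T.mulVec y) :=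
        setIntegral_le_integral hi' (Filter.Eventually.of_forall fun y => hf _)

/-! ### Affine normalization -/

/-- Any point of the support, pulled far enough toward `x₀`, enters the level set `f x₀ / e`. If the
level directions spanned a proper subspace, `f` would vanish off a null affine subspace and have
integral `0`. -/
theorem IsLogConcave.exists_frame {d : ℕ} {f : (Fin d → ℝ) → ℝ} (hf : IsLogConcave f)
    (hpos : 0 < ∫ x, f x) {x₀ : Fin d → ℝ} (h0 : 0 < f x₀) :
    ∃ T : Matrix (Fin d) (Fin d) ℝ, T.det ≠ 0 ∧
      ∀ j, f x₀ * Real.exp (-1) ≤ f (x₀ + T.col j) := by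
  set K : Set (Fin d → ℝ) := {v | f x₀ * Real.exp (-1) ≤ f (x₀ + v)} with hK
  have hsupp : ∀ x, 0 < f x → x - x₀ ∈ Submodule.span ℝ K := by
    intro x hx
    set s := Real.log (f x / f x₀) with hs
    have hfx : f x₀ * Real.exp s = f x := by
      rw [hs, Real.exp_log (by positivity)]
      field_simp
    set p : ℝ := (1 + |s|)⁻¹ with hp
    have hp0 : 0 < p := by positivity
    have hp1 : p ≤ 1 := inv_le_one_of_one_le₀ (by linarith [abs_nonneg s])
    have h1 := hf.mul_exp_le (x := x₀) (y := x) (s := 0) (t := s) h0 hp0.le hp1 (by simp) hfx.le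
    have h2 : p • (x - x₀) ∈ K := by
      rw [hK, Set.mem_ofPred_eq]
      have h3 : x₀ + p • (x - x₀) = (1 - p) • x₀ + p • x := by
        module
      rw [h3]
      refine le_trans ?_ h1
      gcongr
      have : p * |s| ≤ 1 := by
        rw [hp, inv_mul_le_iff₀ (by positivity)]
        linarith
      have h5 : p * (-|s|) ≤ p * s := by gcongr; exact neg_abs_le s
      linarith
    have h4 := Submodule.smul_mem _ p⁻¹ (Submodule.subset_span (R := ℝ) h2)
    rwa [smul_smul, inv_mul_cancel₀ hp0.ne', one_smul] at h4
  have hspan : Submodule.span ℝ K = ⊤ := by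
    by_contra hne
    have hz := Measure.addHaar_submodule (volume : Measure (Fin d → ℝ)) _ hne
    have hae : f =ᵐ[volume] 0 := by
      have h6 : volume ((fun x => x - x₀) ⁻¹' (Submodule.span ℝ K : Set (Fin d → ℝ))) = 0 := by
        simp_rw [sub_eq_add_neg]
        rw [measure_preimage_add_right]
        exact hz
      refine measure_mono_null (fun x hx => ?_) h6
      exact hsupp x (lt_of_le_of_ne (hf.1 x) (Ne.symm hx))
    rw [integral_congr_ae hae] at hpos
    simp at hpos
  obtain ⟨v, hvK, -, hli⟩ := Submodule.exists_fun_fin_finrank_span_eq ℝ K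
  have hfr : Module.finrank ℝ (Submodule.span ℝ K) = d := by
    rw [hspan, finrank_top]; simp
  let e : Fin d ≃ Fin (Module.finrank ℝ (Submodule.span ℝ K)) := finCongr hfr.symm
  refine ⟨Matrix.of fun i j => v (e j) i, ?_, fun j => hvK (e j)⟩
  have : LinearIndependent ℝ (Matrix.of fun i j => v (e j) i : Matrix (Fin d) (Fin d) ℝ).col :=
    hli.comp e e.injective
  rw [Matrix.linearIndependent_cols_iff_isUnit] at this
  exact ((Matrix.isUnit_iff_isUnit_det _).1 this).ne_zero

/-- The supremum need not be attained, hence the factor `e`. It is finite because a huge value at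
`x` forces large values on a parallelepiped of fixed volume halfway between `x₁` and `x`. -/
theorem IsLogConcave.exists_near_max {d : ℕ} [NeZero d] {f : (Fin d → ℝ) → ℝ} (hf : IsLogConcave f)
    (hi : Integrable f) (hpos : 0 < ∫ x, f x) :
    ∃ x₀, 0 < f x₀ ∧ ∀ x, f x ≤ f x₀ * Real.exp 1 := by
  have hd : (0 : ℝ) < d := by exact_mod_cast Nat.pos_of_ne_zero (NeZero.ne d)
  obtain ⟨x₁, h1⟩ : ∃ x, 0 < f x := by
    by_contra! h
    exact hpos.not_ge (integral_nonpos h)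
  have hbdd : ∃ B, ∀ x, f x ≤ B := by
    obtain ⟨T, hT, hTc⟩ := hf.exists_frame hpos h1
    set a := f x₁ * Real.exp (-1) with ha
    have ha0 : 0 < a := by positivity
    have hax : a ≤ f x₁ := by
      rw [ha]
      exact mul_le_of_le_one_right h1.le (Real.exp_le_one_iff.2 (by norm_num))
    set V : ℝ := (d : ℝ)⁻¹ ^ d * |((1 / 2 : ℝ) • T).det| with hV
    have hV0 : 0 < V := by
      have : ((1 / 2 : ℝ) • T).det ≠ 0 := by rw [Matrix.det_smul]; positivity
      positivity
    -- Chosen so that `a * (s / 2) * V` is the whole integral, which `a * exp (s / 2) * V` exceeds.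
    set s := 2 * ((∫ x, f x) / (a * V)) with hs
    refine ⟨a * Real.exp s, fun x => ?_⟩
    by_contra! hx
    have hb : ∀ y ∈ Set.Icc (0 : Fin d → ℝ) (fun _ => (d : ℝ)⁻¹), a * Real.exp (s / 2) ≤
        f (((1 / 2 : ℝ) • x₁ + (1 / 2 : ℝ) • x) + ((1 / 2 : ℝ) • T).mulVec y) := by
      intro y hy
      have h2 := hf.le_of_mem_box hax hTc hy
      have h3 := hf.mul_exp_le (s := 0) (p := 1 / 2) ha0 (by norm_num) (by norm_num)
        (by simpa using h2) hx.le
      convert h3 using 2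
      · ring_nf
      · rw [Matrix.smul_mulVec]; module
    have h4 := mul_pow_mul_abs_det_le_integral hf.1 hi (by positivity) hb
    rw [mul_assoc, ← hV] at h4
    have h5 : s / 2 + 1 ≤ Real.exp (s / 2) := Real.add_one_le_exp _
    have h6 : (∫ x, f x) = a * (s / 2) * V := by rw [hs]; field_simp
    have h7 : a * (s / 2) * V < a * Real.exp (s / 2) * V := by gcongr; linarith
    linarith
  obtain ⟨B, hB⟩ := hbdd
  have hB' : BddAbove (Set.range f) := ⟨B, by rintro _ ⟨x, rfl⟩; exact hB x⟩
  have hM : 0 < ⨆ x, f x := h1.trans_le (le_ciSup hB' x₁)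
  obtain ⟨x₀, hx₀⟩ := exists_lt_of_lt_ciSup (show (⨆ x, f x) * Real.exp (-1) < ⨆ x, f x from
    mul_lt_of_lt_one_right hM (Real.exp_lt_one_iff.2 (by norm_num)))
  refine ⟨x₀, lt_trans (by positivity) hx₀, fun x => (le_ciSup hB' x).trans ?_⟩
  rw [Real.exp_neg, ← div_eq_mul_inv, div_lt_iff₀ (Real.exp_pos _)] at hx₀
  exact hx₀.le

/-- A log-concave function is comparable, after an affine change of variables, to a function that
is bounded below on a box and decays exponentially. -/
theorem IsLogConcave.exists_affine_normalization {d : ℕ} [NeZero d] {f : (Fin d → ℝ) → ℝ}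
    (hf : IsLogConcave f) (hi : Integrable f) (hpos : 0 < ∫ x, f x) :
    ∃ (x₀ : Fin d → ℝ) (T : Matrix (Fin d) (Fin d) ℝ), 0 < f x₀ ∧ T.det ≠ 0 ∧
      (∀ x, f x ≤ f x₀ * Real.exp 1) ∧
      (∀ y ∈ Set.Icc (0 : Fin d → ℝ) (fun _ => (d : ℝ)⁻¹),
        f x₀ * Real.exp (-1) ≤ f (x₀ + T.mulVec y)) ∧
      ∀ y, f (x₀ + T.mulVec y) ≤ f x₀ * Real.exp (2 - ‖y‖ / 3) := by
  obtain ⟨x₀, h0, hmax⟩ := hf.exists_near_max hi hpos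
  have hd : (0 : ℝ) < d := by exact_mod_cast Nat.pos_of_ne_zero (NeZero.ne d)
  have hself : f x₀ * Real.exp (-1) ≤ f x₀ :=
    mul_le_of_le_one_right h0.le (Real.exp_le_one_iff.2 (by norm_num))
  -- The admissible determinants are bounded, since their simplices carry mass at most `∫ f`. A
  -- value above half the supremum is enough.
  set D : Set ℝ := {r | ∃ T : Matrix (Fin d) (Fin d) ℝ,
    (∀ j, f x₀ * Real.exp (-1) ≤ f (x₀ + T.col j)) ∧ |T.det| = r} with hD
  have hDb : BddAbove D := by
    refine ⟨(∫ x, f x) / (f x₀ * Real.exp (-1) * (d : ℝ)⁻¹ ^ d), ?_⟩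
    rintro _ ⟨T, hT, rfl⟩
    rw [le_div_iff₀ (by positivity), mul_comm]
    exact mul_pow_mul_abs_det_le_integral hf.1 hi (by positivity)
      fun y hy => hf.le_of_mem_box hself hT hy
  obtain ⟨T₁, hT₁, hT₁c⟩ := hf.exists_frame hpos h0
  have hDpos : 0 < sSup D := (abs_pos.2 hT₁).trans_le (le_csSup hDb ⟨T₁, hT₁c, rfl⟩)
  obtain ⟨_, ⟨T, hTc, rfl⟩, hTD⟩ := exists_lt_of_lt_csSup (s := D) ⟨_, T₁, hT₁c, rfl⟩ (half_lt_self hDpos)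
  have hT : T.det ≠ 0 := by
    rw [← abs_pos]; linarith
  -- Replacing column `i` of `T` by `T y` keeps the matrix admissible and multiplies the determinant
  -- by `y i`, so `|y i| ≤ 2` by near-maximality.
  have hbound : ∀ y, f x₀ * Real.exp (-1) ≤ f (x₀ + T.mulVec y) → ‖y‖ ≤ 2 := by
    intro y hy
    rw [pi_norm_le_iff_of_nonneg (by norm_num)]
    intro i
    have h1 : T.cramer (T.mulVec y) = T.det • y := by
      rw [Matrix.cramer_eq_adjugate_mulVec, Matrix.mulVec_mulVec, Matrix.adjugate_mul,
        Matrix.smul_mulVec, Matrix.one_mulVec]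
    have h2 : (T.updateCol i (T.mulVec y)).det = T.det * y i := by
      rw [← Matrix.cramer_apply, h1]; simp
    have h3 : |(T.updateCol i (T.mulVec y)).det| ≤ sSup D := by
      refine le_csSup hDb ⟨_, fun j => ?_, rfl⟩
      by_cases hj : j = i
      · subst hj
        convert hy using 3
        ext k; simp [Matrix.col]
      · convert hTc j using 3
        ext k; simp [Matrix.col, Matrix.updateCol_ne hj]
    rw [h2, abs_mul] at h3
    rw [Real.norm_eq_abs]
    by_contra! hlt
    have : |T.det| * 2 < |T.det| * |y i| := by gcongr
    linarith
  refine ⟨x₀, T, h0, hT, hmax, fun y hy => hf.le_of_mem_box hself hTc hy, fun y => ?_⟩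
  rcases le_or_gt ‖y‖ 3 with hy | hy
  · refine (hmax _).trans ?_
    gcongr
    linarith
  -- A violation at `‖y‖ > 3` interpolates with `x₀` to a point with `‖y‖ = 3` still in the level
  -- set, against the bound `2`.
  by_contra! hlt
  have h1 : f x₀ * Real.exp (-(‖y‖ / 3)) ≤ f (x₀ + T.mulVec y) := by
    refine le_trans ?_ hlt.le
    gcongr
    linarith
  have hp1 : 3 / ‖y‖ ≤ 1 := by rw [div_le_one (by linarith)]; exact hy.le
  have h2 := hf.mul_exp_le (x := x₀) (s := 0) (p := 3 / ‖y‖) h0 (by positivity) hp1 (by simp) h1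
  have h3 : (1 - 3 / ‖y‖) * 0 + 3 / ‖y‖ * -(‖y‖ / 3) = -1 := by
    have : ‖y‖ ≠ 0 := by linarith
    field_simp
    ring
  have h4 : (1 - 3 / ‖y‖) • x₀ + (3 / ‖y‖) • (x₀ + T.mulVec y)
      = x₀ + T.mulVec ((3 / ‖y‖) • y) := by
    rw [Matrix.mulVec_smul]; module
  rw [h3, h4] at h2
  have h5 := hbound _ h2
  rw [norm_smul, Real.norm_of_nonneg (by positivity), div_mul_cancel₀ _ (by linarith)] at h5
  norm_num at h5

/-! ### Exponential decay and integrability of moments -/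

theorem integrable_norm_pow_mul_exp {d : ℕ} {a : ℝ} (ha : 0 < a) (n : ℕ) :
    Integrable fun x : Fin d → ℝ => ‖x‖ ^ n * Real.exp (-(a * ‖x‖)) := by
  -- The extra `d + 1` powers leave the integrable weight `(1 + ‖x‖) ^ (-(d + 1))`.
  set N := n + (d + 1) with hN
  have h1 : Integrable fun x : Fin d → ℝ => (1 + ‖x‖) ^ (-((d : ℝ) + 1)) :=
    integrable_one_add_norm (by simp)
  refine (h1.const_mul (N.factorial / a ^ N * Real.exp a)).mono'
    (by fun_prop) (Filter.Eventually.of_forall fun x => ?_)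
  set t := ‖x‖ with ht
  have ht0 : 0 ≤ t := norm_nonneg x
  have h2 := Real.pow_div_factorial_le_exp (a * (1 + t)) (by positivity) N
  have h3 : (1 + t) ^ (-((d : ℝ) + 1)) = ((1 + t) ^ (d + 1))⁻¹ := by
    rw [Real.rpow_neg (by positivity)]
    norm_cast
  rw [Real.norm_of_nonneg (by positivity), h3, ← div_eq_mul_inv, le_div_iff₀ (by positivity)]
  have h4 : (1 + t) ^ N ≤ N.factorial / a ^ N * Real.exp (a * (1 + t)) := by
    rw [div_le_iff₀ (by positivity), mul_pow] at h2
    rw [div_mul_eq_mul_div, le_div_iff₀ (by positivity)]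
    linarith
  have h5 : t ^ n ≤ (1 + t) ^ n := by gcongr; linarith
  calc t ^ n * Real.exp (-(a * t)) * (1 + t) ^ (d + 1)
      ≤ (1 + t) ^ n * Real.exp (-(a * t)) * (1 + t) ^ (d + 1) := by gcongr
    _ = (1 + t) ^ N * Real.exp (-(a * t)) := by rw [hN]; ring
    _ ≤ N.factorial / a ^ N * Real.exp (a * (1 + t)) * Real.exp (-(a * t)) := by gcongr
    _ = N.factorial / a ^ N * Real.exp a := by
        rw [mul_assoc, ← Real.exp_add]; ring_nf

theorem norm_mulVec_le_of_abs_le {d : ℕ} {T : Matrix (Fin d) (Fin d) ℝ} {B : ℝ}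
    (hT : ∀ i j, |T i j| ≤ B) (hB : 0 ≤ B) (y : Fin d → ℝ) : ‖T.mulVec y‖ ≤ d * B * ‖y‖ := by
  rw [pi_norm_le_iff_of_nonneg (by positivity)]
  intro i
  calc ‖T.mulVec y i‖ ≤ ∑ j, ‖T i j * y j‖ := by
        rw [Matrix.mulVec, dotProduct]; exact norm_sum_le _ _
    _ ≤ ∑ _j : Fin d, B * ‖y‖ := by
        gcongr with j
        rw [norm_mul]
        exact mul_le_mul (hT i j) (norm_le_pi_norm y j) (norm_nonneg _) hB
    _ = d * B * ‖y‖ := by simp [mul_assoc]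

theorem mulVec_inv_mulVec {d : ℕ} {T : Matrix (Fin d) (Fin d) ℝ} (hT : T.det ≠ 0)
    (y : Fin d → ℝ) : T.mulVec (T⁻¹.mulVec y) = y := by
  rw [Matrix.mulVec_mulVec, Matrix.mul_nonsing_inv _ hT.isUnit, Matrix.one_mulVec]

theorem inv_mulVec_mulVec {d : ℕ} {T : Matrix (Fin d) (Fin d) ℝ} (hT : T.det ≠ 0)
    (y : Fin d → ℝ) : T⁻¹.mulVec (T.mulVec y) = y := by
  rw [Matrix.mulVec_mulVec, Matrix.nonsing_inv_mul _ hT.isUnit, Matrix.one_mulVec]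

/-- Undoes the affine normalization. The constants depend on `f`, so this serves integrability and
summability only, never the uniform bounds. -/
theorem IsLogConcave.exists_exp_bound {d : ℕ} [NeZero d] {f : (Fin d → ℝ) → ℝ}
    (hf : IsLogConcave f) (hi : Integrable f) (hpos : 0 < ∫ x, f x) :
    ∃ A a : ℝ, 0 < A ∧ 0 < a ∧ ∀ x, f x ≤ A * Real.exp (-(a * ‖x‖)) := by
  obtain ⟨x₀, T, h0, hT, -, -, hdec⟩ := hf.exists_affine_normalization hi hpos
  set B := 1 + ∑ i, ∑ j, |T i j| with hBdef
  have hB : 0 < B := by positivity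
  have hTB : ∀ i j, |T i j| ≤ B := by
    intro i j
    have h1 : |T i j| ≤ ∑ j, |T i j| :=
      Finset.single_le_sum (f := fun j => |T i j|) (fun _ _ => abs_nonneg _) (Finset.mem_univ j)
    have h2 : ∑ j, |T i j| ≤ ∑ i, ∑ j, |T i j| :=
      Finset.single_le_sum (f := fun i => ∑ j, |T i j|)
        (fun _ _ => Finset.sum_nonneg fun _ _ => abs_nonneg _) (Finset.mem_univ i)
    linarith
  have hd : (0 : ℝ) < d := by exact_mod_cast Nat.pos_of_ne_zero (NeZero.ne d)
  set a := (3 * (d * B))⁻¹ with ha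
  refine ⟨f x₀ * Real.exp (2 + a * ‖x₀‖), a, by positivity, by positivity, fun x => ?_⟩
  have h1 := hdec (T⁻¹.mulVec (x - x₀))
  have h2 := norm_mulVec_le_of_abs_le hTB hB.le (T⁻¹.mulVec (x - x₀))
  rw [mulVec_inv_mulVec hT] at h1 h2
  rw [add_sub_cancel] at h1
  refine h1.trans ?_
  rw [mul_assoc, ← Real.exp_add]
  gcongr
  have h3 : ‖x‖ - ‖x₀‖ ≤ ‖x - x₀‖ := norm_sub_norm_le x x₀
  have h4 : a * ‖x - x₀‖ ≤ a * (d * B * ‖T⁻¹.mulVec (x - x₀)‖) := by gcongr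
  have h5 : a * (d * B * ‖T⁻¹.mulVec (x - x₀)‖) = ‖T⁻¹.mulVec (x - x₀)‖ / 3 := by
    rw [ha]; field_simp
  have h6 : a * (‖x‖ - ‖x₀‖) ≤ a * ‖x - x₀‖ := by gcongr
  linarith

theorem IsLogConcave.integrable_mul {d : ℕ} [NeZero d] {f : (Fin d → ℝ) → ℝ}
    (hf : IsLogConcave f) (hi : Integrable f) (hpos : 0 < ∫ x, f x) {u : (Fin d → ℝ) → ℝ}
    (hu : Continuous u) {n : ℕ} (hun : ∀ x, |u x| ≤ ‖x‖ ^ n) :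
    Integrable fun x => u x * f x := by
  obtain ⟨A, a, hA, ha, h⟩ := hf.exists_exp_bound hi hpos
  refine ((integrable_norm_pow_mul_exp ha n).const_mul A).mono'
    (hu.aestronglyMeasurable.mul hi.aestronglyMeasurable)
    (Filter.Eventually.of_forall fun x => ?_)
  rw [norm_mul, Real.norm_eq_abs, Real.norm_of_nonneg (hf.1 x)]
  calc |u x| * f x ≤ ‖x‖ ^ n * (A * Real.exp (-(a * ‖x‖))) :=
        mul_le_mul (hun x) (h x) (hf.1 x) (by positivity)
    _ = _ := by ring

theorem IsLogConcave.integrable_coord_mul {d : ℕ} [NeZero d] {f : (Fin d → ℝ) → ℝ}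
    (hf : IsLogConcave f) (hi : Integrable f) (hpos : 0 < ∫ x, f x) (i : Fin d) :
    Integrable fun x => x i * f x :=
  hf.integrable_mul hi hpos (u := fun x => x i) (n := 1) (by fun_prop)
    fun x => by simpa using norm_le_pi_norm x i

theorem IsLogConcave.integrable_coord_mul_coord_mul {d : ℕ} [NeZero d] {f : (Fin d → ℝ) → ℝ}
    (hf : IsLogConcave f) (hi : Integrable f) (hpos : 0 < ∫ x, f x) (i j : Fin d) :
    Integrable fun x => x i * x j * f x :=
  hf.integrable_mul hi hpos (u := fun x => x i * x j) (n := 2) (by fun_prop)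
    fun x => by
      rw [abs_mul, sq]
      exact mul_le_mul (norm_le_pi_norm x i) (norm_le_pi_norm x j) (abs_nonneg _) (norm_nonneg _)

/-! ### Isotropy controls the normalizing matrix -/

theorem integral_coord_mul_coord_mul {d : ℕ} {f : (Fin d → ℝ) → ℝ} (h1 : ∫ x, f x = 1)
    (hc : IsCentered f) {σ : ℝ} (hσ : covMatrix f = σ ^ 2 • (1 : Matrix (Fin d) (Fin d) ℝ))
    (i j : Fin d) : ∫ x, x i * x j * f x = σ ^ 2 * (1 : Matrix (Fin d) (Fin d) ℝ) i j := by
  have h := congrFun (congrFun hσ i) j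
  simpa [covMatrix, h1, hc i] using h

theorem integral_dotProduct_sub_sq_mul {d : ℕ} [NeZero d] {f : (Fin d → ℝ) → ℝ}
    (hf : IsLogConcave f) (hi : Integrable f) (h1 : ∫ x, f x = 1) (hc : IsCentered f) {σ : ℝ}
    (hσ : covMatrix f = σ ^ 2 • (1 : Matrix (Fin d) (Fin d) ℝ)) (s : Fin d → ℝ) (c : ℝ) :
    ∫ x, (s ⬝ᵥ x - c) ^ 2 * f x = σ ^ 2 * ∑ a, s a ^ 2 + c ^ 2 := by
  have hpos : 0 < ∫ x, f x := by rw [h1]; exact one_pos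
  have hI2 := hf.integrable_coord_mul_coord_mul hi hpos
  have hI1 := hf.integrable_coord_mul hi hpos
  have e : (fun x => (s ⬝ᵥ x - c) ^ 2 * f x) = fun x =>
      (∑ a, ∑ b, (s a * s b) * (x a * x b * f x)) + ((∑ a, (-2 * c * s a) * (x a * f x)) +
        c ^ 2 * f x) := by
    funext x
    have e1 : ∑ a, ∑ b, (s a * s b) * (x a * x b * f x) = (s ⬝ᵥ x) ^ 2 * f x := by
      rw [sq, dotProduct, Finset.sum_mul_sum, Finset.sum_mul]
      refine Finset.sum_congr rfl fun a _ => ?_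
      rw [Finset.sum_mul]
      exact Finset.sum_congr rfl fun b _ => by ring
    have e2 : ∑ a, (-2 * c * s a) * (x a * f x) = -2 * c * (s ⬝ᵥ x) * f x := by
      rw [dotProduct, Finset.mul_sum, Finset.sum_mul]
      exact Finset.sum_congr rfl fun b _ => by ring
    rw [e1, e2]; ring
  rw [e, integral_add, integral_add, integral_finsetSum, integral_finsetSum]
  · simp_rw [integral_const_mul, h1]
    have e3 : ∀ a, ∫ x, ∑ b, (s a * s b) * (x a * x b * f x) = s a ^ 2 * σ ^ 2 := by
      intro a
      rw [integral_finsetSum]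
      · simp_rw [integral_const_mul, integral_coord_mul_coord_mul h1 hc hσ, Matrix.one_apply]
        simp only [mul_ite, mul_one, mul_zero, Finset.sum_ite_eq, Finset.mem_univ, if_true]
        ring
      · exact fun b _ => (hI2 a b).const_mul _
    simp_rw [e3, hc _]
    simp [mul_comm, Finset.mul_sum]
  · exact fun a _ => (hI1 a).const_mul _
  · exact fun a _ => integrable_finsetSum _ fun b _ => (hI2 a b).const_mul _
  · exact integrable_finsetSum _ fun a _ => (hI1 a).const_mul _
  · exact hi.const_mul _
  · exact integrable_finsetSum _ fun a _ => integrable_finsetSum _ fun b _ => (hI2 a b).const_mul _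
  · exact (integrable_finsetSum _ fun a _ => (hI1 a).const_mul _).add (hi.const_mul _)

/-- Row `j` of `T⁻¹` applied to `x - x₀` is the coordinate `y j`. Its second moment is at least `σ ^
2` times the squared length of the row, and the decay in `y` bounds it above. -/
theorem inv_apply_bound {d : ℕ} [NeZero d] {f : (Fin d → ℝ) → ℝ}
    (hf : IsLogConcave f) (hi : Integrable f) (h1 : ∫ x, f x = 1) (hc : IsCentered f) {σ : ℝ}
    (hσ0 : 0 < σ) (hσ : covMatrix f = σ ^ 2 • (1 : Matrix (Fin d) (Fin d) ℝ))
    {x₀ : Fin d → ℝ} {T : Matrix (Fin d) (Fin d) ℝ} (hT : T.det ≠ 0) {M : ℝ}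
    (hdec : ∀ y, f (x₀ + T.mulVec y) ≤ M * Real.exp (2 - ‖y‖ / 3)) (j a : Fin d) :
    |T⁻¹ j a| ≤ √(|T.det| * M * Real.exp 2 *
      ∫ y : Fin d → ℝ, ‖y‖ ^ 2 * Real.exp (-(1 / 3 * ‖y‖))) / σ := by
  have hint := integral_dotProduct_sub_sq_mul hf hi h1 hc hσ (T⁻¹ j) (T⁻¹ j ⬝ᵥ x₀)
  rw [← integral_comp_add_mulVec x₀ hT] at hint
  have e : ∀ y, T⁻¹ j ⬝ᵥ (x₀ + T.mulVec y) - T⁻¹ j ⬝ᵥ x₀ = y j := by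
    intro y
    have := congrFun (inv_mulVec_mulVec hT y) j
    rw [dotProduct_add, add_sub_cancel_left]
    exact this
  simp_rw [e] at hint
  have hle : ∫ y : Fin d → ℝ, y j ^ 2 * f (x₀ + T.mulVec y) ≤
      ∫ y : Fin d → ℝ, M * Real.exp 2 * (‖y‖ ^ 2 * Real.exp (-(1 / 3 * ‖y‖))) := by
    refine integral_mono_of_nonneg (Filter.Eventually.of_forall fun y => mul_nonneg (sq_nonneg _)
      (hf.1 _)) ((integrable_norm_pow_mul_exp (by norm_num) 2).const_mul _)
      (Filter.Eventually.of_forall fun y => ?_)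
    have h2 : y j ^ 2 ≤ ‖y‖ ^ 2 := sq_le_sq.2 (by simpa using norm_le_pi_norm y j)
    calc y j ^ 2 * f (x₀ + T.mulVec y) ≤ ‖y‖ ^ 2 * (M * Real.exp (2 - ‖y‖ / 3)) :=
          mul_le_mul h2 (hdec y) (hf.1 _) (by positivity)
      _ = M * Real.exp 2 * (‖y‖ ^ 2 * Real.exp (-(1 / 3 * ‖y‖))) := by
        rw [sub_eq_add_neg, Real.exp_add]; ring_nf
  rw [integral_const_mul] at hle
  have hrow : T⁻¹ j a ^ 2 ≤ ∑ a, T⁻¹ j a ^ 2 :=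
    Finset.single_le_sum (f := fun a => T⁻¹ j a ^ 2) (fun _ _ => sq_nonneg _) (Finset.mem_univ a)
  rw [le_div_iff₀ hσ0]
  refine Real.le_sqrt_of_sq_le ?_
  rw [mul_pow, sq_abs]
  calc T⁻¹ j a ^ 2 * σ ^ 2 ≤ σ ^ 2 * ∑ a, T⁻¹ j a ^ 2 + (T⁻¹ j ⬝ᵥ x₀) ^ 2 := by
        nlinarith [mul_le_mul_of_nonneg_left hrow (sq_nonneg σ), sq_nonneg (T⁻¹ j ⬝ᵥ x₀)]
    _ ≤ |T.det| * (M * Real.exp 2 *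
          ∫ y : Fin d → ℝ, ‖y‖ ^ 2 * Real.exp (-(1 / 3 * ‖y‖))) := by
        rw [← hint]; gcongr
    _ = _ := by ring

/-- The variance `σ ^ 2` of `x i` is bounded below using two points of the box differing by `h` in
direction `j`: there `x i` differs by `t = h * T i j`, and `φ² + (φ + t)² ≥ t² / 2` whatever `φ` is.
-/
theorem apply_bound {d : ℕ} [NeZero d] {f : (Fin d → ℝ) → ℝ}
    (hf : IsLogConcave f) (hi : Integrable f) (h1 : ∫ x, f x = 1) (hc : IsCentered f) {σ : ℝ}
    (hσ : covMatrix f = σ ^ 2 • (1 : Matrix (Fin d) (Fin d) ℝ))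
    {x₀ : Fin d → ℝ} {T : Matrix (Fin d) (Fin d) ℝ} (hT : T.det ≠ 0) {a h : ℝ} (ha : 0 ≤ a)
    (hh : 0 ≤ h)
    (hbox : ∀ y ∈ Set.Icc (0 : Fin d → ℝ) (fun _ => 2 * h), a ≤ f (x₀ + T.mulVec y))
    (i j : Fin d) :
    |T.det| * a * h ^ (d + 2) * T i j ^ 2 ≤ 4 * σ ^ 2 := by
  have hpos : 0 < ∫ x, f x := by rw [h1]; exact one_pos
  set F : (Fin d → ℝ) → ℝ := fun x => x i * x i * f x with hF
  have hF0 : ∀ x, 0 ≤ F x := fun x => mul_nonneg (mul_self_nonneg _) (hf.1 x)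
  have hFi : Integrable F := hf.integrable_coord_mul_coord_mul hi hpos i i
  have hFint : ∫ x, F x = σ ^ 2 := by
    simpa using integral_coord_mul_coord_mul h1 hc hσ i i
  have hGi : Integrable fun y => F (x₀ + T.mulVec y) := (integrable_comp_add_mulVec x₀ hT).2 hFi
  set e : Fin d → ℝ := Pi.single j h with he
  have hGi' : Integrable fun y => F (x₀ + T.mulVec (y + e)) := hGi.comp_add_right e
  have hG' : ∫ y, F (x₀ + T.mulVec (y + e)) = ∫ y, F (x₀ + T.mulVec y) :=
    integral_add_right_eq_self (fun y => F (x₀ + T.mulVec y)) e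
  have hT2 := integral_comp_add_mulVec x₀ hT F
  rw [hFint] at hT2
  have key : ∀ y ∈ Set.Icc (0 : Fin d → ℝ) (fun _ => h),
      a * (h * T i j) ^ 2 / 2 ≤ F (x₀ + T.mulVec y) + F (x₀ + T.mulVec (y + e)) := by
    intro y hy
    have hb1 := hbox y ⟨hy.1, fun k => (hy.2 k).trans (by simp only; linarith)⟩
    have hb2 := hbox (y + e) ⟨fun k => ?_, fun k => ?_⟩
    · have hshift : (x₀ + T.mulVec (y + e)) i = (x₀ + T.mulVec y) i + h * T i j := by
        simp [he, Matrix.mulVec_add, Matrix.mulVec_single, add_assoc]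
      simp only [hF]
      rw [hshift]
      set φ := (x₀ + T.mulVec y) i
      set t := h * T i j
      calc a * t ^ 2 / 2 ≤ φ * φ * a + (φ + t) * (φ + t) * a := by
            nlinarith [mul_nonneg ha (sq_nonneg (2 * φ + t))]
        _ ≤ _ := by
          gcongr
          · exact mul_self_nonneg _
          · exact mul_self_nonneg _
    · have := hy.1 k
      simp only [he, Pi.add_apply, Pi.single_apply]
      simp only [Pi.zero_apply] at this ⊢
      split_ifs <;> linarith
    · have := hy.2 k
      simp only [he, Pi.add_apply, Pi.single_apply]
      simp only at this ⊢
      split_ifs <;> linarith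
  have hset : a * (h * T i j) ^ 2 / 2 * h ^ d ≤ 2 * ∫ y, F (x₀ + T.mulVec y) := by
    calc a * (h * T i j) ^ 2 / 2 * h ^ d
        = ∫ _y in Set.Icc (0 : Fin d → ℝ) (fun _ => h), a * (h * T i j) ^ 2 / 2 := by
          rw [setIntegral_const, volume_real_box hh, smul_eq_mul, mul_comm]
      _ ≤ ∫ y in Set.Icc (0 : Fin d → ℝ) (fun _ => h),
            (F (x₀ + T.mulVec y) + F (x₀ + T.mulVec (y + e))) :=
          setIntegral_mono_on (integrableOn_const (by simp [Real.volume_Icc_pi]))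
            (hGi.add hGi').integrableOn measurableSet_Icc key
      _ ≤ ∫ y, (F (x₀ + T.mulVec y) + F (x₀ + T.mulVec (y + e))) :=
          setIntegral_le_integral (hGi.add hGi')
            (Filter.Eventually.of_forall fun y => add_nonneg (hF0 _) (hF0 _))
      _ = 2 * ∫ y, F (x₀ + T.mulVec y) := by rw [integral_add hGi hGi', hG']; ring
  have := mul_le_mul_of_nonneg_left hset (abs_nonneg T.det)
  rw [← hT2]
  calc |T.det| * a * h ^ (d + 2) * T i j ^ 2
      = 2 * (|T.det| * (a * (h * T i j) ^ 2 / 2 * h ^ d)) := by ring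
    _ ≤ 2 * (|T.det| * (2 * ∫ y, F (x₀ + T.mulVec y))) := by gcongr
    _ = _ := by ring

theorem abs_integral_mul_comp_le {d : ℕ} {f : (Fin d → ℝ) → ℝ} (hf : ∀ x, 0 ≤ f x)
    {x₀ : Fin d → ℝ} {T : Matrix (Fin d) (Fin d) ℝ} {M B : ℝ} (hB : 0 ≤ B) {n : ℕ}
    {u : (Fin d → ℝ) → ℝ} (hu : ∀ y, |u y| ≤ B * ‖y‖ ^ n)
    (hdec : ∀ y, f (x₀ + T.mulVec y) ≤ M * Real.exp (2 - ‖y‖ / 3)) :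
    |∫ y, u y * f (x₀ + T.mulVec y)| ≤ B * (M * Real.exp 2 *
      ∫ y : Fin d → ℝ, ‖y‖ ^ n * Real.exp (-(1 / 3 * ‖y‖))) := by
  rw [← integral_const_mul, ← integral_const_mul, ← Real.norm_eq_abs]
  have hint : Integrable fun y : Fin d → ℝ => ‖y‖ ^ n * Real.exp (-(1 / 3 * ‖y‖)) :=
    integrable_norm_pow_mul_exp (by norm_num) n
  refine norm_integral_le_of_norm_le ((hint.const_mul _).const_mul _)
    (Filter.Eventually.of_forall fun y => ?_)
  rw [norm_mul, Real.norm_of_nonneg (hf _)]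
  calc ‖u y‖ * f (x₀ + T.mulVec y) ≤ (B * ‖y‖ ^ n) * (M * Real.exp (2 - ‖y‖ / 3)) :=
        mul_le_mul (hu y) (hdec y) (hf _) (by positivity)
    _ = _ := by
        rw [sub_eq_add_neg, Real.exp_add]; ring_nf

set_option maxHeartbeats 1000000 in
/-- Uniform bounds for isotropic log-concave densities of covariance `σ ^ 2 • 1`. -/
theorem exists_isotropic_bounds (d : ℕ) [NeZero d] : ∃ A c r : ℝ, 0 < A ∧ 0 < c ∧ 0 < r ∧
    ∀ (f : (Fin d → ℝ) → ℝ) (σ : ℝ), IsLogConcave f → IsDensity f → IsCentered f → 0 < σ →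
      covMatrix f = σ ^ 2 • (1 : Matrix (Fin d) (Fin d) ℝ) →
      ∃ (z : Fin d → ℝ) (m : ℝ), 0 < m ∧ m * σ ^ d ≤ A ∧ ‖z‖ ≤ A * σ ∧
        (∀ x, f x ≤ m * Real.exp 1) ∧
        (∀ x, ‖x - z‖ ≤ r * σ → m * Real.exp (-1) ≤ f x) ∧
        ∀ x, f x ≤ m * Real.exp (A - c * (‖x - z‖ / σ)) := by
  have hd : (0 : ℝ) < d := by exact_mod_cast Nat.pos_of_ne_zero (NeZero.ne d)
  set Q : ℕ → ℝ := fun n => ∫ y : Fin d → ℝ, ‖y‖ ^ n * Real.exp (-(1 / 3 * ‖y‖)) with hQ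
  have hQ0 : ∀ n, 0 ≤ Q n := fun n => integral_nonneg fun y => by positivity
  set h : ℝ := (2 * d)⁻¹ with hh
  have hh0 : 0 < h := by positivity
  have h2h : 2 * h = (d : ℝ)⁻¹ := by rw [hh]; field_simp
  -- bound for `|det T| * m`
  set q : ℝ := Real.exp 1 / (d : ℝ)⁻¹ ^ d with hq
  have hq0 : 0 < q := by positivity
  -- bound for the entries of `T⁻¹`, times `σ`
  set C₂ : ℝ := √(q * Real.exp 2 * Q 2) with hC₂
  have hC₂0 : 0 ≤ C₂ := Real.sqrt_nonneg _
  -- bound for the entries of `T`, divided by `σ`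
  set C₃ : ℝ := √(4 * (Real.exp 2 * Q 0) * Real.exp 1 / h ^ (d + 2)) with hC₃
  have hC₃0 : 0 ≤ C₃ := Real.sqrt_nonneg _
  set L : ℝ := d * C₃ + 1 with hL
  have hL0 : 0 < L := by positivity
  set C₄ : ℝ := L * (q * Real.exp 2 * Q 1) with hC₄
  have hC₄0 : 0 ≤ C₄ := mul_nonneg hL0.le (mul_nonneg (by positivity) (hQ0 1))
  set A : ℝ := q * (d.factorial * C₂ ^ d) + (C₄ + L * h) + (2 + h) with hA
  have hA1 : 0 ≤ q * (d.factorial * C₂ ^ d) := by positivity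
  have hA2 : 0 ≤ C₄ + L * h := by positivity
  have hA3 : q * (d.factorial * C₂ ^ d) ≤ A := by rw [hA]; linarith
  have hA4 : C₄ + L * h ≤ A := by rw [hA]; linarith
  have hA5 : 2 + h / 3 ≤ A := by rw [hA]; linarith
  have hA0 : 0 < A := by linarith
  clear_value A
  refine ⟨A, (3 * L)⁻¹, h / (d * C₂ + 1), hA0, by positivity, by positivity, ?_⟩
  intro f σ hf hdens hc hσ0 hσ
  obtain ⟨-, hi, h1⟩ := hdens
  have hpos : 0 < ∫ x, f x := by rw [h1]; exact one_pos
  obtain ⟨x₀, T, hm, hT, hmax, hbox, hdec⟩ := hf.exists_affine_normalization hi hpos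
  set m := f x₀ with hmdef
  have hdet : 0 < |T.det| := abs_pos.2 hT
  have hq1 : |T.det| * m ≤ q := by
    have := mul_pow_mul_abs_det_le_integral hf.1 hi (by positivity) hbox
    rw [h1, Real.exp_neg] at this
    rw [hq, le_div_iff₀ (by positivity)]
    calc |T.det| * m * (d : ℝ)⁻¹ ^ d
        = m * (Real.exp 1)⁻¹ * (d : ℝ)⁻¹ ^ d * |T.det| * Real.exp 1 := by field_simp
      _ ≤ 1 * Real.exp 1 := by gcongr
      _ = Real.exp 1 := one_mul _
  -- Total mass `1` bounds `|det T| * m` from below; this removes that factor from the estimate of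
  -- `apply_bound`.
  have hq2 : 1 ≤ |T.det| * (m * Real.exp 2 * Q 0) := by
    have e := integral_comp_add_mulVec x₀ hT f
    have := abs_integral_mul_comp_le (u := fun _ => 1) (n := 0) hf.1 zero_le_one (by simp) hdec
    simp only [one_mul] at this
    rw [← h1, ← e]
    gcongr
    exact (le_abs_self _).trans this
  have hTinv : ∀ i j, |T⁻¹ i j| ≤ C₂ / σ := by
    intro i j
    refine (inv_apply_bound hf hi h1 hc hσ0 hσ hT hdec i j).trans ?_
    rw [hC₂]
    gcongr
  have hTent : ∀ i j, |T i j| ≤ C₃ * σ := by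
    intro i j
    have hb := apply_bound hf hi h1 hc hσ hT (a := m * Real.exp (-1)) (by positivity) hh0.le
      (by rw [h2h]; exact hbox) i j
    rw [← div_le_iff₀ hσ0]
    refine Real.le_sqrt_of_sq_le ?_
    rw [div_pow, sq_abs, div_le_div_iff₀ (by positivity) (by positivity)]
    rw [Real.exp_neg] at hb
    have hb' : |T.det| * m * (h ^ (d + 2) * T i j ^ 2) ≤ 4 * σ ^ 2 * Real.exp 1 := by
      calc |T.det| * m * (h ^ (d + 2) * T i j ^ 2)
          = |T.det| * (m * (Real.exp 1)⁻¹) * h ^ (d + 2) * T i j ^ 2 * Real.exp 1 := by field_simp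
        _ ≤ _ := by gcongr
    have hX : 0 ≤ h ^ (d + 2) * T i j ^ 2 := by positivity
    calc T i j ^ 2 * h ^ (d + 2) = 1 * (h ^ (d + 2) * T i j ^ 2) := by ring
      _ ≤ |T.det| * (m * Real.exp 2 * Q 0) * (h ^ (d + 2) * T i j ^ 2) := by gcongr
      _ = (Real.exp 2 * Q 0) * (|T.det| * m * (h ^ (d + 2) * T i j ^ 2)) := by ring
      _ ≤ (Real.exp 2 * Q 0) * (4 * σ ^ 2 * Real.exp 1) := by
          have := hQ0 0
          gcongr
      _ = _ := by ring
  have hTnorm : ∀ y, ‖T.mulVec y‖ ≤ L * σ * ‖y‖ := by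
    intro y
    refine (norm_mulVec_le_of_abs_le hTent (by positivity) y).trans ?_
    refine mul_le_mul_of_nonneg_right ?_ (norm_nonneg y)
    rw [hL]
    linarith
  have hx₀ : ‖x₀‖ ≤ C₄ * σ := by
    rw [pi_norm_le_iff_of_nonneg (by positivity)]
    intro i
    have e := integral_comp_add_mulVec x₀ hT fun x => x i * f x
    rw [hc i] at e
    have e0 := integral_comp_add_mulVec x₀ hT f
    have hgi := (integrable_comp_add_mulVec x₀ hT).2 hi
    have hgi2 := (integrable_comp_add_mulVec x₀ hT).2 (hf.integrable_coord_mul hi hpos i)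
    have esplit : ∀ y, T.mulVec y i * f (x₀ + T.mulVec y) =
        (x₀ + T.mulVec y) i * f (x₀ + T.mulVec y) - x₀ i * f (x₀ + T.mulVec y) := by
      intro y
      rw [Pi.add_apply]; ring
    -- Centering says that the mean of `T y` is `-x₀`, so decay in `y` locates `x₀`.
    have e3 : |T.det| * ∫ y, T.mulVec y i * f (x₀ + T.mulVec y) = - x₀ i := by
      simp_rw [esplit]
      rw [integral_sub hgi2 (hgi.const_mul _), integral_const_mul, mul_sub, e, mul_left_comm, e0,
        h1]
      ring
    have hb := abs_integral_mul_comp_le (u := fun y => T.mulVec y i) (n := 1) (B := L * σ)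
      hf.1 (by positivity)
      (fun y => by rw [pow_one]; exact (norm_le_pi_norm (T.mulVec y) i).trans (hTnorm y)) hdec
    rw [Real.norm_eq_abs, ← abs_neg, ← e3, abs_mul, abs_abs]
    calc |T.det| * |∫ y, T.mulVec y i * f (x₀ + T.mulVec y)|
        ≤ |T.det| * (L * σ * (m * Real.exp 2 * Q 1)) := by gcongr
      _ = L * σ * (|T.det| * m * Real.exp 2 * Q 1) := by ring
      _ ≤ L * σ * (q * Real.exp 2 * Q 1) := by
          have := hQ0 1
          gcongr
      _ = C₄ * σ := by rw [hC₄]; ring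
  -- The centre of the box of side `2 * h = 1 / d`; moving the base point there makes the box
  -- contain a ball about `z`.
  set y₀ : Fin d → ℝ := fun _ => h with hy₀
  have hy₀n : ‖y₀‖ ≤ h := by
    rw [pi_norm_le_iff_of_nonneg hh0.le]
    intro i
    simp [hy₀, abs_of_pos hh0]
  have hTy₀ : ‖T.mulVec y₀‖ ≤ L * h * σ := by
    refine (hTnorm y₀).trans ?_
    rw [mul_right_comm]; gcongr
  refine ⟨x₀ + T.mulVec y₀, m, hm, ?_, ?_, hmax, ?_, ?_⟩
  · have hdi : |T⁻¹.det| ≤ d.factorial * (C₂ / σ) ^ d := by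
      have := Matrix.det_le (abv := AbsoluteValue.abs) (A := T⁻¹) hTinv
      simpa using this
    rw [Matrix.det_nonsing_inv, Ring.inverse_eq_inv', abs_inv, div_pow, mul_div_assoc',
      le_div_iff₀ (by positivity)] at hdi
    calc m * σ ^ d = (|T.det| * m) * (|T.det|⁻¹ * σ ^ d) := by field_simp
      _ ≤ q * (d.factorial * C₂ ^ d) := by gcongr
      _ ≤ A := hA3
  · calc ‖x₀ + T.mulVec y₀‖ ≤ C₄ * σ + L * h * σ := (norm_add_le _ _).trans (add_le_add hx₀ hTy₀)
      _ = (C₄ + L * h) * σ := by ring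
      _ ≤ A * σ := by gcongr
  · intro x hx
    set v := T⁻¹.mulVec (x - (x₀ + T.mulVec y₀)) with hv
    have hvn : ‖v‖ ≤ h := by
      refine (norm_mulVec_le_of_abs_le hTinv (by positivity) _).trans ?_
      calc d * (C₂ / σ) * ‖x - (x₀ + T.mulVec y₀)‖
          ≤ d * (C₂ / σ) * (h / (d * C₂ + 1) * σ) := by gcongr
        _ = d * C₂ * h / (d * C₂ + 1) := by field_simp
        _ ≤ h := by rw [div_le_iff₀ (by positivity)]; nlinarith
    have hx' : x = x₀ + T.mulVec (y₀ + v) := by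
      rw [Matrix.mulVec_add, hv, mulVec_inv_mulVec hT]; abel
    rw [hx']
    refine hbox _ ⟨fun i => ?_, fun i => ?_⟩
    · have := abs_le.1 ((norm_le_pi_norm v i).trans hvn)
      simp only [hy₀, Pi.add_apply, Pi.zero_apply]
      linarith
    · have := abs_le.1 ((norm_le_pi_norm v i).trans hvn)
      simp only [hy₀, Pi.add_apply]
      linarith
  · intro x
    have hb := hdec (T⁻¹.mulVec (x - x₀))
    have hn := hTnorm (T⁻¹.mulVec (x - x₀))
    rw [mulVec_inv_mulVec hT] at hb hn
    rw [add_sub_cancel] at hb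
    refine hb.trans (mul_le_mul_of_nonneg_left (Real.exp_le_exp.2 ?_) hm.le)
    set y := T⁻¹.mulVec (x - x₀)
    have hz : ‖x - (x₀ + T.mulVec y₀)‖ ≤ L * σ * ‖y‖ + L * h * σ := by
      rw [← sub_sub]
      exact (norm_sub_le _ _).trans (add_le_add hn hTy₀)
    have : (3 * L)⁻¹ * (‖x - (x₀ + T.mulVec y₀)‖ / σ) ≤ ‖y‖ / 3 + h / 3 := by
      calc _ ≤ (3 * L)⁻¹ * ((L * σ * ‖y‖ + L * h * σ) / σ) := by gcongr
        _ = _ := by field_simp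
    linarith

/-! ### Lattice sums as integrals of step functions -/

/-- The coordinatewise integer part. -/
noncomputable def latticeFloor {d : ℕ} (x : Fin d → ℝ) : Fin d → ℤ := fun i => ⌊x i⌋

theorem measurable_latticeFloor {d : ℕ} : Measurable (latticeFloor (d := d)) :=
  measurable_pi_lambda _ fun i => Int.measurable_floor.comp (measurable_pi_apply i)

/-- Each fibre is a half-open unit cube, of volume `1`. Lattice sums thereby become integrals, and
integrability gives summability. -/
theorem map_latticeFloor_volume {d : ℕ} :
    Measure.map (latticeFloor (d := d)) volume = Measure.count := by
  rw [Measure.ext_iff_singleton]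
  intro k
  rw [Measure.map_apply measurable_latticeFloor (measurableSet_singleton k),
    Measure.count_singleton]
  have : latticeFloor ⁻¹' {k} = Set.univ.pi fun i => Set.Ico (k i : ℝ) (k i + 1) := by
    ext x
    simp [latticeFloor, funext_iff, Int.floor_eq_iff]
  rw [this, Real.volume_pi_Ico]
  simp

theorem summable_of_integrable_comp_latticeFloor {d : ℕ} {u : (Fin d → ℤ) → ℝ}
    (hu : Integrable fun x => u (latticeFloor x)) : Summable u := by
  have h : Integrable u (Measure.map latticeFloor volume) :=
    (integrable_map_measure (Measurable.of_discrete.aestronglyMeasurable)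
      measurable_latticeFloor.aemeasurable).2 hu
  rw [map_latticeFloor_volume] at h
  exact (integrable_count_iff.1 h).of_norm

theorem tsum_eq_integral_comp_latticeFloor {d : ℕ} {u : (Fin d → ℤ) → ℝ}
    (hu : Integrable fun x => u (latticeFloor x)) : ∑' k, u k = ∫ x, u (latticeFloor x) := by
  have hm : AEStronglyMeasurable u (Measure.map latticeFloor volume) :=
    Measurable.of_discrete.aestronglyMeasurable
  have h := (integrable_map_measure hm measurable_latticeFloor.aemeasurable).2 hu
  rw [← integral_map measurable_latticeFloor.aemeasurable hm]
  rw [map_latticeFloor_volume] at h ⊢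
  rw [integral_countable h]
  simp

theorem norm_latticeFloor_sub_le {d : ℕ} (x : Fin d → ℝ) :
    ‖latticePoint (latticeFloor x) - x‖ ≤ 1 := by
  rw [pi_norm_le_iff_of_nonneg zero_le_one]
  intro i
  simp only [latticePoint, latticeFloor, Pi.sub_apply, Real.norm_eq_abs]
  rw [abs_sub_comm, abs_of_nonneg (Int.fract_nonneg _)]
  exact (Int.fract_lt_one _).le

theorem integrable_latticeFloor_of_exp_bound {d : ℕ} {u : (Fin d → ℝ) → ℝ} {A a : ℝ} (ha : 0 < a)
    (hu : ∀ x, |u x| ≤ (1 + ‖x‖) * (A * Real.exp (-(a * ‖x‖)))) :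
    Integrable fun x => u (latticePoint (latticeFloor x)) := by
  have hA : 0 ≤ A := by
    have := (abs_nonneg _).trans (hu 0)
    simpa using this
  have h0 := integrable_norm_pow_mul_exp (d := d) ha 0
  have h1 := integrable_norm_pow_mul_exp (d := d) ha 1
  have hm : Measurable fun x : Fin d → ℝ => u (latticePoint (latticeFloor x)) :=
    (Measurable.of_discrete (f := fun k => u (latticePoint k))).comp measurable_latticeFloor
  refine (((h0.const_mul 2).add h1).const_mul (A * Real.exp a)).mono' hm.aestronglyMeasurable
    (Filter.Eventually.of_forall fun x => ?_)
  set p := latticePoint (latticeFloor x) with hp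
  have hpx : ‖p - x‖ ≤ 1 := norm_latticeFloor_sub_le x
  have hn1 : ‖p‖ ≤ ‖x‖ + 1 := by
    have := norm_sub_norm_le p x; linarith
  have hn2 : ‖x‖ ≤ ‖p‖ + 1 := by
    have := norm_sub_norm_le x p; rw [norm_sub_rev] at this; linarith
  refine (hu p).trans ?_
  calc (1 + ‖p‖) * (A * Real.exp (-(a * ‖p‖)))
      ≤ (2 + ‖x‖) * (A * Real.exp (a - a * ‖x‖)) := by
        gcongr ?_ * (A * Real.exp ?_)
        · linarith
        · nlinarith
    _ = _ := by
        simp only [Pi.add_apply]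
        rw [sub_eq_add_neg, Real.exp_add]; ring

/-! ### Comparing lattice sum and integral by homotheties -/

theorem integrable_comp_homothety {d : ℕ} (z : Fin d → ℝ) {ρ : ℝ} (hρ : 0 < ρ)
    {G : (Fin d → ℝ) → ℝ} (hG : Integrable G) :
    Integrable (fun x => G (z + ρ • (x - z))) ∧
      ∫ x, G (z + ρ • (x - z)) = (ρ ^ d)⁻¹ * ∫ x, G x := by
  set T : Matrix (Fin d) (Fin d) ℝ := ρ • 1 with hTdef
  have hdet : T.det = ρ ^ d := by simp [hTdef]
  have hT : T.det ≠ 0 := by rw [hdet]; positivity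
  have e : ∀ x, z + ρ • (x - z) = (z - ρ • z) + T.mulVec x := by
    intro x
    rw [hTdef, Matrix.smul_mulVec, Matrix.one_mulVec]; module
  simp_rw [e]
  refine ⟨(integrable_comp_add_mulVec _ hT).2 hG, ?_⟩
  rw [← integral_comp_add_mulVec (z - ρ • z) hT G, hdet, abs_of_pos (by positivity),
    inv_mul_cancel_left₀ (by positivity)]

/-- Since `f x ≤ m e` and `f b ≥ m / e`, going from `x` to `b` loses at most a factor `e ^ 2`; going
a fraction `ε` of the way loses at most `exp (2 ε)`. -/
theorem IsLogConcave.mul_exp_neg_le {E : Type*} [AddCommGroup E] [Module ℝ E] {f : E → ℝ}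
    (hf : IsLogConcave f) {m ε : ℝ} (h0 : 0 ≤ ε) (h1 : ε ≤ 1) (hmax : ∀ x, f x ≤ m * Real.exp 1)
    (x : E) {b : E} (hb : m * Real.exp (-1) ≤ f b) :
    Real.exp (-(2 * ε)) * f x ≤ f ((1 - ε) • x + ε • b) := by
  rcases (hf.1 x).eq_or_lt with hx | hx
  · rw [← hx, mul_zero]; exact hf.1 _
  have := hf.mul_exp_le (x := x) (y := b) (s := 0) (t := -2) (p := ε) hx h0 h1 (by simp) ?_
  · rw [mul_comm]
    convert this using 3
    ring
  · refine le_trans ?_ hb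
    calc f x * Real.exp (-2) ≤ m * Real.exp 1 * Real.exp (-2) := by
          gcongr; exact hmax x
      _ = m * Real.exp (-1) := by rw [mul_assoc, ← Real.exp_add]; norm_num

/-- Comparison of a lattice sum with the integral, for a log-concave function that is nearly
maximal on the ball of radius `ε⁻¹`. -/
theorem IsLogConcave.integral_latticeFloor_bounds {d : ℕ} {f w : (Fin d → ℝ) → ℝ}
    (hf : IsLogConcave f) (hi : Integrable f) (h1 : ∫ x, f x = 1)
    {z : Fin d → ℝ} {m ε : ℝ} (h0 : 0 < ε) (hε : ε < 1) (hmax : ∀ x, f x ≤ m * Real.exp 1)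
    (hball : ∀ x, ‖x - z‖ ≤ ε⁻¹ → m * Real.exp (-1) ≤ f x)
    (hzi : Integrable fun x => ‖x - z‖ * f x) (hw0 : ∀ x, 0 ≤ w x)
    (hw : ∀ x y, w x ≤ w y + ‖x - y‖) (hwi : Integrable fun x => w x * f x)
    (hpi : Integrable fun x => w (latticePoint (latticeFloor x)) *
      f (latticePoint (latticeFloor x))) :
    (∫ x, w (latticePoint (latticeFloor x)) * f (latticePoint (latticeFloor x)) ≤
      Real.exp (2 * ε) * ((1 - ε) ^ d)⁻¹ *
        ((∫ x, w x * f x) + ε / (1 - ε) * (∫ x, ‖x - z‖ * f x) + 1)) ∧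
    Real.exp (-(2 * ε)) * (1 - ε) ^ d *
        ((∫ x, w x * f x) - ε * (∫ x, ‖x - z‖ * f x) - 1) ≤
      ∫ x, w (latticePoint (latticeFloor x)) * f (latticePoint (latticeFloor x)) := by
  set ρ := 1 - ε with hρdef
  have hρ : 0 < ρ := by linarith
  have hρε : ε = 1 - ρ := by linarith
  constructor
  · set G : (Fin d → ℝ) → ℝ := fun y => w y * f y + ε / ρ * (‖y - z‖ * f y) + f y with hG
    have hi2 : Integrable fun y => w y * f y + ε / ρ * (‖y - z‖ * f y) :=
      hwi.add (hzi.const_mul _)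
    have hGi : Integrable G := hi2.add hi
    have hGint : ∫ y, G y = (∫ x, w x * f x) + ε / ρ * (∫ x, ‖x - z‖ * f x) + 1 := by
      simp only [hG]
      rw [integral_add hi2 hi, integral_add hwi (hzi.const_mul _),
        integral_const_mul, h1]
    obtain ⟨hGi', hGint'⟩ := integrable_comp_homothety z hρ hGi
    rw [← hGint, mul_assoc, ← hGint', ← integral_const_mul]
    refine integral_mono hpi (hGi'.const_mul _) fun x => ?_
    set p := latticePoint (latticeFloor x) with hp
    have hpx : ‖p - x‖ ≤ 1 := norm_latticeFloor_sub_le x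
    set y := z + ρ • (x - z) with hy
    have hfp : Real.exp (-(2 * ε)) * f p ≤ f y := by
      -- The point `b` solving `(1 - ε) p + ε b = y`; it stays in the ball because rounding moves
      -- `x` by at most `1`.
      have hb := hball (z + (ρ / ε) • (x - p)) (by
        rw [add_sub_cancel_left, norm_smul, Real.norm_of_nonneg (by positivity), norm_sub_rev,
          div_eq_mul_inv]
        have : 0 < ε⁻¹ := by positivity
        calc ρ * ε⁻¹ * ‖p - x‖ ≤ 1 * ε⁻¹ * 1 := by gcongr; linarith
          _ = ε⁻¹ := by ring)
      convert hf.mul_exp_neg_le h0.le hε.le hmax p hb using 2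
      rw [smul_add, smul_smul, mul_div_cancel₀ _ h0.ne', hy, ← hρdef, hρε]
      module
    have hwp : w p ≤ w y + ε / ρ * ‖y - z‖ + 1 := by
      have h2 := hw p x
      have h3 := hw x y
      have h4 : x - y = (ε / ρ) • (y - z) := by
        rw [hy, add_sub_cancel_left, smul_smul, div_mul_cancel₀ _ hρ.ne', hρε]
        module
      rw [h4, norm_smul, Real.norm_of_nonneg (by positivity)] at h3
      linarith
    have hfp' : f p ≤ Real.exp (2 * ε) * f y := by
      calc f p = Real.exp (2 * ε) * (Real.exp (-(2 * ε)) * f p) := by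
            rw [← mul_assoc, ← Real.exp_add]; simp
        _ ≤ _ := by gcongr
    calc w p * f p ≤ (w y + ε / ρ * ‖y - z‖ + 1) * (Real.exp (2 * ε) * f y) :=
          mul_le_mul hwp hfp' (hf.1 p) ((hw0 p).trans hwp)
      _ = Real.exp (2 * ε) * G y := by simp only [hG]; ring
  · set G : (Fin d → ℝ) → ℝ := fun y => w y * f y - ε * (‖y - z‖ * f y) - f y with hG
    have hi2 : Integrable fun y => w y * f y - ε * (‖y - z‖ * f y) :=
      hwi.sub (hzi.const_mul _)
    have hGi : Integrable G := hi2.sub hi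
    have hGint : ∫ y, G y = (∫ x, w x * f x) - ε * (∫ x, ‖x - z‖ * f x) - 1 := by
      simp only [hG]
      rw [integral_sub hi2 hi, integral_sub hwi (hzi.const_mul _),
        integral_const_mul, h1]
    obtain ⟨hGi', hGint'⟩ := integrable_comp_homothety z (inv_pos.2 hρ) hGi
    rw [inv_pow, inv_inv] at hGint'
    rw [← hGint, mul_assoc, ← hGint', ← integral_const_mul]
    refine integral_mono (hGi'.const_mul _) hpi fun x => ?_
    set p := latticePoint (latticeFloor x) with hp
    have hpx : ‖p - x‖ ≤ 1 := norm_latticeFloor_sub_le x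
    set y := z + ρ⁻¹ • (x - z) with hy
    have hfp : Real.exp (-(2 * ε)) * f y ≤ f p := by
      -- Here `b` solves `(1 - ε) y + ε b = p`.
      have hb := hball (z + ε⁻¹ • (p - x)) (by
        rw [add_sub_cancel_left, norm_smul, Real.norm_of_nonneg (by positivity)]
        exact mul_le_of_le_one_right (by positivity) hpx)
      convert hf.mul_exp_neg_le h0.le hε.le hmax y hb using 2
      rw [smul_add ε, smul_smul ε, mul_inv_cancel₀ h0.ne', hy, smul_add, smul_smul, ← hρdef,
        mul_inv_cancel₀ hρ.ne', hρε]
      module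
    have hwp : w y - ε * ‖y - z‖ - 1 ≤ w p := by
      have h2 := hw x p
      have h3 := hw y x
      have h4 : y - x = ε • (y - z) := by
        have : x = z + ρ • (y - z) := by
          rw [hy, add_sub_cancel_left, smul_smul, mul_inv_cancel₀ hρ.ne', one_smul]; abel
        rw [this, hρε]
        module
      rw [h4, norm_smul, Real.norm_of_nonneg h0.le] at h3
      rw [norm_sub_rev] at h2
      linarith
    calc Real.exp (-(2 * ε)) * G y
        = (w y - ε * ‖y - z‖ - 1) * (Real.exp (-(2 * ε)) * f y) := by simp only [hG]; ring
      _ ≤ w p * (Real.exp (-(2 * ε)) * f y) :=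
          mul_le_mul_of_nonneg_right hwp (mul_nonneg (Real.exp_pos _).le (hf.1 y))
      _ ≤ w p * f p := mul_le_mul_of_nonneg_left hfp (hw0 p)

/-- The prefactors are `1 + O(ε)`, and `ε` times either moment is at most `B`, so the multiplicative
error becomes a bounded additive one. -/
theorem IsLogConcave.abs_integral_latticeFloor_sub_le {d : ℕ} {f w : (Fin d → ℝ) → ℝ}
    (hf : IsLogConcave f) (hi : Integrable f) (h1 : ∫ x, f x = 1)
    {z : Fin d → ℝ} {m ε B : ℝ} (h0 : 0 < ε) (hε : ε ≤ 1 / 2) (hmax : ∀ x, f x ≤ m * Real.exp 1)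
    (hball : ∀ x, ‖x - z‖ ≤ ε⁻¹ → m * Real.exp (-1) ≤ f x)
    (hzi : Integrable fun x => ‖x - z‖ * f x) (hw0 : ∀ x, 0 ≤ w x)
    (hw : ∀ x y, w x ≤ w y + ‖x - y‖) (hwi : Integrable fun x => w x * f x)
    (hpi : Integrable fun x => w (latticePoint (latticeFloor x)) *
      f (latticePoint (latticeFloor x)))
    (hwB : ε * (∫ x, w x * f x) ≤ B) (hzB : ε * (∫ x, ‖x - z‖ * f x) ≤ B) :
    |(∫ x, w (latticePoint (latticeFloor x)) * f (latticePoint (latticeFloor x))) -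
      ∫ x, w x * f x| ≤ Real.exp (1 + d) * ((2 + 2 * d) * B + 2 * B + 1) := by
  obtain ⟨hU, hL⟩ := hf.integral_latticeFloor_bounds hi h1 h0 (by linarith) hmax hball hzi hw0 hw
    hwi hpi
  set S := ∫ x, w (latticePoint (latticeFloor x)) * f (latticePoint (latticeFloor x))
  set W := ∫ x, w x * f x with hW
  set K := ∫ x, ‖x - z‖ * f x with hK
  have hW0 : 0 ≤ W := integral_nonneg fun x => mul_nonneg (hw0 x) (hf.1 x)
  have hK0 : 0 ≤ K := integral_nonneg fun x => mul_nonneg (norm_nonneg _) (hf.1 x)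
  have hρ : 0 < 1 - ε := by linarith
  have hB : 0 ≤ B := le_trans (by positivity) hzB
  -- Total exponent: `2 ε` from `f`, and `2 ε` per dimension from `1 - ε ≥ exp (-2 ε)`, valid for `ε
  -- ≤ 1 / 2`.
  set t : ℝ := (2 + 2 * d) * ε with ht
  have ht0 : 0 ≤ t := by positivity
  have ht1 : t ≤ 1 + d := by rw [ht]; nlinarith
  have hρe : Real.exp (-(2 * ε)) ≤ 1 - ε := by
    rw [Real.exp_neg]
    refine inv_le_of_inv_le₀ hρ ?_
    refine le_trans ?_ (Real.add_one_le_exp (2 * ε))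
    rw [inv_le_iff_one_le_mul₀ hρ]
    nlinarith
  have hφ : Real.exp (-t) ≤ Real.exp (-(2 * ε)) * (1 - ε) ^ d := by
    calc Real.exp (-t) = Real.exp (-(2 * ε)) * Real.exp (-(2 * ε)) ^ d := by
          rw [← Real.exp_nat_mul, ← Real.exp_add, ht]; congr 1; ring
      _ ≤ _ := by gcongr
  have hφ1 : Real.exp (-(2 * ε)) * (1 - ε) ^ d ≤ 1 :=
    mul_le_one₀ (Real.exp_le_one_iff.2 (by linarith)) (by positivity)
      (pow_le_one₀ hρ.le (by linarith))
  set φ := Real.exp (-(2 * ε)) * (1 - ε) ^ d with hφdef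
  have hφinv : Real.exp (2 * ε) * ((1 - ε) ^ d)⁻¹ ≤ Real.exp t := by
    have h2 : Real.exp (2 * ε) * ((1 - ε) ^ d)⁻¹ = φ⁻¹ := by
      rw [hφdef, mul_inv, Real.exp_neg, inv_inv]
    rw [h2]
    refine inv_le_of_inv_le₀ (Real.exp_pos t) ?_
    rwa [← Real.exp_neg]
  have het : Real.exp t ≤ 1 + t * Real.exp (1 + d) := by
    have h3 : (1 - t) * Real.exp t ≤ 1 := by
      calc (1 - t) * Real.exp t ≤ Real.exp (-t) * Real.exp t := by
            gcongr; exact Real.one_sub_le_exp_neg t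
        _ = 1 := by rw [← Real.exp_add]; simp
    have h4 : t * Real.exp t ≤ t * Real.exp (1 + d) := by gcongr
    linarith
  have het2 : Real.exp t ≤ Real.exp (1 + d) := Real.exp_le_exp.2 ht1
  have he1 : 1 ≤ Real.exp (1 + (d : ℝ)) := Real.one_le_exp (by positivity)
  have htW : t * W ≤ (2 + 2 * d) * B := by
    rw [ht, mul_assoc]; gcongr
  have htW0 : 0 ≤ t * W := by positivity
  rw [abs_sub_le_iff]
  constructor
  · have hεK : ε / (1 - ε) * K ≤ 2 * B := by
      calc ε / (1 - ε) * K ≤ ε / (1 / 2) * K := by gcongr; linarith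
        _ = 2 * (ε * K) := by ring
        _ ≤ 2 * B := by gcongr
    have hS : S ≤ Real.exp t * (W + 2 * B + 1) := by
      refine hU.trans ?_
      gcongr
    have h5 : Real.exp t * W ≤ W + Real.exp (1 + d) * ((2 + 2 * d) * B) := by
      calc Real.exp t * W ≤ (1 + t * Real.exp (1 + d)) * W := by gcongr
        _ = W + Real.exp (1 + d) * (t * W) := by ring
        _ ≤ _ := by gcongr
    have h6 : Real.exp t * (2 * B + 1) ≤ Real.exp (1 + d) * (2 * B + 1) := by gcongr
    linarith
  · have h7 : 1 - t ≤ φ := (Real.one_sub_le_exp_neg t).trans hφ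
    have h8 : W - t * W ≤ φ * W := by nlinarith
    have h9 : φ * (ε * K + 1) ≤ B + 1 := by
      calc φ * (ε * K + 1) ≤ 1 * (B + 1) := by gcongr
        _ = B + 1 := one_mul _
    have h10 : (2 + 2 * (d : ℝ)) * B + 2 * B + 1 ≤
        Real.exp (1 + d) * ((2 + 2 * d) * B + 2 * B + 1) :=
      le_mul_of_one_le_left (by positivity) he1
    linarith

/-! ### The uniform bound for isotropic densities -/

theorem summable_norm_mul_exp_latticePoint (d : ℕ) {c : ℝ} (hc : 0 < c) :
    Summable fun k : Fin d → ℤ => ‖latticePoint k‖ * Real.exp (-(c * ‖latticePoint k‖)) := by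
  refine summable_of_integrable_comp_latticeFloor
    (integrable_latticeFloor_of_exp_bound (u := fun x => ‖x‖ * Real.exp (-(c * ‖x‖))) (A := 1)
      hc fun x => ?_)
  rw [abs_of_nonneg (by positivity), one_mul]
  gcongr
  linarith

theorem one_le_norm_latticePoint {d : ℕ} {k : Fin d → ℤ} {i : Fin d} (hk : k i ≠ 0) :
    1 ≤ ‖latticePoint k‖ := by
  refine le_trans ?_ (norm_le_pi_norm (latticePoint k) i)
  simp only [latticePoint, Real.norm_eq_abs]
  exact_mod_cast Int.one_le_abs hk

theorem inv_pow_le_mul_exp {c σ : ℝ} (hc : 0 < c) (hσ : 0 < σ) (n : ℕ) :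
    (σ ^ n)⁻¹ ≤ n.factorial / c ^ n * Real.exp (c / σ) := by
  have h := Real.pow_div_factorial_le_exp (c / σ) (by positivity) n
  rw [div_pow, div_div, div_le_iff₀ (by positivity)] at h
  rw [inv_le_iff_one_le_mul₀ (by positivity), div_mul_eq_mul_div, div_mul_eq_mul_div,
    le_div_iff₀ (by positivity), one_mul]
  linarith

theorem integral_norm_mul_le {d : ℕ} [NeZero d] {f : (Fin d → ℝ) → ℝ}
    (hf : IsLogConcave f) (hi : Integrable f) (h1 : ∫ x, f x = 1) (hc : IsCentered f) {σ : ℝ}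
    (hσ0 : 0 < σ) (hσ : covMatrix f = σ ^ 2 • (1 : Matrix (Fin d) (Fin d) ℝ)) :
    Integrable (fun x => ‖x‖ * f x) ∧ ∫ x, ‖x‖ * f x ≤ d * σ := by
  have hpos : 0 < ∫ x, f x := by rw [h1]; exact one_pos
  have hI := hf.integrable_mul hi hpos (u := fun x => ‖x‖) (n := 1) (by fun_prop) (by simp)
  have hI2 := hf.integrable_coord_mul_coord_mul hi hpos
  refine ⟨hI, ?_⟩
  have hs : ∀ i : Fin d, Integrable fun x : Fin d → ℝ =>
      (2 * σ)⁻¹ * (x i * x i * f x) + σ / 2 * f x :=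
    fun i => ((hI2 i i).const_mul _).add (hi.const_mul _)
  calc ∫ x, ‖x‖ * f x ≤ ∫ x, ∑ i, ((2 * σ)⁻¹ * (x i * x i * f x) + σ / 2 * f x) := by
        refine integral_mono hI (integrable_finsetSum _ fun i _ => hs i) fun x => ?_
        have hx : ‖x‖ ≤ ∑ i, |x i| := by
          rw [pi_norm_le_iff_of_nonneg (Finset.sum_nonneg fun _ _ => abs_nonneg _)]
          exact fun i => Finset.single_le_sum (f := fun i => |x i|) (fun _ _ => abs_nonneg _)
            (Finset.mem_univ i)
        calc ‖x‖ * f x ≤ (∑ i, |x i|) * f x := mul_le_mul_of_nonneg_right hx (hf.1 x)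
          _ = ∑ i, |x i| * f x := Finset.sum_mul _ _ _
          _ ≤ ∑ i, ((2 * σ)⁻¹ * (x i * x i * f x) + σ / 2 * f x) := by
            gcongr with i
            -- Arithmetic-geometric mean inequality, balanced at `|x i| = σ`.
            have h2 : |x i| ≤ (2 * σ)⁻¹ * (x i * x i) + σ / 2 := by
              rw [← abs_mul_abs_self (x i), inv_mul_eq_div, ← sub_nonneg]
              have : |x i| * |x i| / (2 * σ) + σ / 2 - |x i| = (|x i| - σ) ^ 2 / (2 * σ) := by
                field_simp; ring
              rw [this]; positivity
            have := mul_le_mul_of_nonneg_right h2 (hf.1 x)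
            linarith
    _ = ∑ _i : Fin d, σ := by
        rw [integral_finsetSum _ fun i _ => hs i]
        refine Finset.sum_congr rfl fun i _ => ?_
        rw [integral_add ((hI2 i i).const_mul _) (hi.const_mul _), integral_const_mul,
          integral_const_mul, h1, integral_coord_mul_coord_mul h1 hc hσ, Matrix.one_apply_eq]
        field_simp; norm_num
    _ = d * σ := by simp

theorem IsLogConcave.integrable_latticeFloor {d : ℕ} [NeZero d] {f w : (Fin d → ℝ) → ℝ}
    (hf : IsLogConcave f) (hi : Integrable f) (hpos : 0 < ∫ x, f x)
    (hw : ∀ x, |w x| ≤ 1 + ‖x‖) :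
    Integrable fun x => w (latticePoint (latticeFloor x)) *
      f (latticePoint (latticeFloor x)) := by
  obtain ⟨A, a, hA, ha, hfA⟩ := hf.exists_exp_bound hi hpos
  refine integrable_latticeFloor_of_exp_bound (u := fun x => w x * f x) (A := A) ha fun x => ?_
  rw [abs_mul, abs_of_nonneg (hf.1 x)]
  exact mul_le_mul (hw x) (hfA x) (hf.1 x) (by positivity)

theorem isotropic_lattice_sum_bound (d : ℕ) [NeZero d] : ∃ C : ℝ, ∀ f : (Fin d → ℝ) → ℝ,
    IsLogConcave f → IsDensity f → IsCentered f → IsIsotropic f → ∀ i : Fin d,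
      |∑' k : Fin d → ℤ, (k i : ℝ) * f (latticePoint k)| ≤ C := by
  obtain ⟨A, c, r, hA, hc, hr, H⟩ := exists_isotropic_bounds d
  set c' : ℝ := c * r / 4 with hc'
  have hc'0 : 0 < c' := by positivity
  set S₀ := ∑' k : Fin d → ℤ, ‖latticePoint k‖ * Real.exp (-(c' * ‖latticePoint k‖)) with hS₀
  set D : ℝ := A * (d.factorial / (c / 2) ^ d) * Real.exp (A + c * A) with hD
  set B : ℝ := (d + A) / r with hB
  set C₁ : ℝ := Real.exp (1 + d) * ((2 + 2 * d) * B + 2 * B + 1) with hC₁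
  refine ⟨max (2 * C₁) (D * S₀), fun f hf hdens hcent hiso i => ?_⟩
  obtain ⟨σ, hσ0, hσ⟩ := hiso
  obtain ⟨z, m, hm, hmA, hz, hmax, hball, hdec⟩ := H f σ hf hdens hcent hσ0 hσ
  obtain ⟨-, hi, h1⟩ := hdens
  have hpos : 0 < ∫ x, f x := by rw [h1]; exact one_pos
  -- The threshold is exactly `ε = (r * σ)⁻¹ ≤ 1 / 2`.
  rcases le_or_gt (2 / r) σ with hσr | hσr
  · refine le_trans ?_ (le_max_left _ _)
    obtain ⟨hni, hnσ⟩ := integral_norm_mul_le hf hi h1 hcent hσ0 hσ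
    have hzi : Integrable fun x => ‖x - z‖ * f x := by
      refine (hni.add (hi.const_mul ‖z‖)).mono' (by
        refine AEStronglyMeasurable.mul ?_ hi.aestronglyMeasurable
        exact Continuous.aestronglyMeasurable (by fun_prop)) (Filter.Eventually.of_forall fun x => ?_)
      rw [norm_mul, norm_norm, Real.norm_of_nonneg (hf.1 x)]
      calc ‖x - z‖ * f x ≤ (‖x‖ + ‖z‖) * f x :=
            mul_le_mul_of_nonneg_right (norm_sub_le x z) (hf.1 x)
        _ = _ := by simp only [Pi.add_apply]; ring
    have hzσ : ∫ x, ‖x - z‖ * f x ≤ (d + A) * σ := by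
      calc ∫ x, ‖x - z‖ * f x ≤ ∫ x, (‖x‖ * f x + ‖z‖ * f x) := by
            refine integral_mono hzi (hni.add (hi.const_mul _)) fun x => ?_
            rw [← add_mul]
            exact mul_le_mul_of_nonneg_right (norm_sub_le x z) (hf.1 x)
        _ = (∫ x, ‖x‖ * f x) + ‖z‖ := by
            rw [integral_add hni (hi.const_mul _), integral_const_mul, h1, mul_one]
        _ ≤ (d + A) * σ := by linarith
    set ε : ℝ := (r * σ)⁻¹ with hε
    have hε0 : 0 < ε := by positivity
    have hε2 : ε ≤ 1 / 2 := by
      rw [hε, one_div]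
      refine inv_anti₀ two_pos ?_
      rwa [div_le_iff₀' hr] at hσr
    have hεσ : ε * ((d + A) * σ) = B := by rw [hε, hB]; field_simp
    have hzB : ε * (∫ x, ‖x - z‖ * f x) ≤ B := by
      rw [← hεσ]; gcongr
    -- The comparison needs nonnegative `1`-Lipschitz weights, so `x i` is split into positive and
    -- negative parts.
    have key : ∀ w : (Fin d → ℝ) → ℝ, Continuous w → (∀ x, 0 ≤ w x) → (∀ x, w x ≤ ‖x‖) →
        (∀ x y, w x ≤ w y + ‖x - y‖) → Integrable (fun x => w x * f x) ∧
        Integrable (fun x => w (latticePoint (latticeFloor x)) *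
          f (latticePoint (latticeFloor x))) ∧
        |(∫ x, w (latticePoint (latticeFloor x)) * f (latticePoint (latticeFloor x))) -
          ∫ x, w x * f x| ≤ C₁ := by
      intro w hwc hw0 hwn hwl
      have hwi : Integrable (fun x => w x * f x) := hf.integrable_mul hi hpos (n := 1) hwc
        fun x => by rw [abs_of_nonneg (hw0 x), pow_one]; exact hwn x
      have hpi := hf.integrable_latticeFloor hi hpos (w := w) fun x => by
        rw [abs_of_nonneg (hw0 x)]; linarith [hwn x]
      refine ⟨hwi, hpi, hf.abs_integral_latticeFloor_sub_le hi h1 hε0 hε2 hmax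
        (by rw [hε, inv_inv]; exact hball) hzi hw0 hwl hwi hpi ?_ hzB⟩
      rw [← hεσ]
      gcongr
      calc ∫ x, w x * f x ≤ ∫ x, ‖x‖ * f x :=
            integral_mono hwi hni fun x => mul_le_mul_of_nonneg_right (hwn x) (hf.1 x)
        _ ≤ d * σ := hnσ
        _ ≤ (d + A) * σ := by gcongr; linarith
    have hcoord : ∀ x : Fin d → ℝ, |x i| ≤ ‖x‖ := fun x => norm_le_pi_norm x i
    obtain ⟨hp1, hp2, hp3⟩ := key (fun x => max (x i) 0) (by fun_prop)
      (fun x => le_max_right _ _)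
      (fun x => max_le ((le_abs_self _).trans (hcoord x)) (norm_nonneg x)) fun x y => by
        have := (le_abs_self _).trans (hcoord (x - y))
        simp only [Pi.sub_apply] at this
        refine max_le ?_ (add_nonneg (le_max_right _ _) (norm_nonneg _))
        linarith [le_max_left (y i) 0]
    obtain ⟨hn1, hn2, hn3⟩ := key (fun x => max (-x i) 0) (by fun_prop)
      (fun x => le_max_right _ _)
      (fun x => max_le ((neg_le_abs _).trans (hcoord x)) (norm_nonneg x)) fun x y => by
        have := (neg_le_abs _).trans (hcoord (x - y))
        simp only [Pi.sub_apply] at this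
        refine max_le ?_ (add_nonneg (le_max_right _ _) (norm_nonneg _))
        linarith [le_max_left (-y i) 0]
    have hsplit : ∀ t : ℝ, max t 0 - max (-t) 0 = t := fun t => by
      rcases le_total t 0 with h | h
      · rw [max_eq_right h, max_eq_left (by linarith)]; ring
      · rw [max_eq_left h, max_eq_right (by linarith)]; ring
    have hzero : (∫ x : Fin d → ℝ, max (x i) 0 * f x) - ∫ x : Fin d → ℝ, max (-x i) 0 * f x
        = 0 := by
      rw [← integral_sub hp1 hn1]
      refine Eq.trans (integral_congr_ae ?_) (hcent i)
      refine (Filter.Eventually.of_forall fun x => ?_)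
      simp only [← sub_mul, hsplit]
    have hsum : ∑' k : Fin d → ℤ, (k i : ℝ) * f (latticePoint k) =
        (∫ x : Fin d → ℝ, max (latticePoint (latticeFloor x) i) 0 *
          f (latticePoint (latticeFloor x))) -
        ∫ x : Fin d → ℝ, max (-latticePoint (latticeFloor x) i) 0 *
          f (latticePoint (latticeFloor x)) := by
      rw [← integral_sub hp2 hn2]
      refine (tsum_eq_integral_comp_latticeFloor
        (u := fun k => (k i : ℝ) * f (latticePoint k)) ?_).trans
        (integral_congr_ae (Filter.Eventually.of_forall fun x => ?_))
      swap
      · simp only [← sub_mul, hsplit]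
        rfl
      exact hf.integrable_latticeFloor hi hpos (w := fun x => x i) fun x => by
        linarith [hcoord x]
    rw [hsum]
    rw [abs_le] at hp3 hn3 ⊢
    constructor <;> linarith
  · refine le_trans ?_ (le_max_right _ _)
    have hsm := summable_norm_mul_exp_latticePoint d hc'0
    rw [hS₀, ← tsum_mul_left, ← Real.norm_eq_abs]
    refine tsum_of_norm_bounded (hsm.mul_left D).hasSum fun k => ?_
    by_cases hk : k i = 0
    · rw [hk]
      simp only [Int.cast_zero, zero_mul, norm_zero]
      positivity
    have hk1 := one_le_norm_latticePoint hk
    set n := ‖latticePoint k‖ with hn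
    have hki : |(k i : ℝ)| ≤ n := norm_le_pi_norm (latticePoint k) i
    have hmσ : m ≤ A * (d.factorial / (c / 2) ^ d * Real.exp (c / 2 / σ)) := by
      calc m = (m * σ ^ d) * (σ ^ d)⁻¹ := by field_simp
        _ ≤ A * (d.factorial / (c / 2) ^ d * Real.exp (c / 2 / σ)) := by
            gcongr
            exact inv_pow_le_mul_exp (by positivity) hσ0 d
    have hfk : f (latticePoint k) ≤ D * Real.exp (-(c' * n)) := by
      refine (hdec _).trans ?_
      calc m * Real.exp (A - c * (‖latticePoint k - z‖ / σ))
          ≤ A * (d.factorial / (c / 2) ^ d * Real.exp (c / 2 / σ)) *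
            Real.exp (A - c * (‖latticePoint k - z‖ / σ)) := by gcongr
        _ = A * (d.factorial / (c / 2) ^ d) *
            Real.exp (c / 2 / σ + (A - c * (‖latticePoint k - z‖ / σ))) := by
            rw [Real.exp_add]; ring
        _ ≤ A * (d.factorial / (c / 2) ^ d) * Real.exp (A + c * A + -(c' * n)) := by
            refine mul_le_mul_of_nonneg_left (Real.exp_le_exp.2 ?_) (by positivity)
            -- Of the decay rate `c n / σ`, one half pays for `exp (c / (2 σ))` because `n ≥ 1`; the
            -- other half is at least `c' n` because `σ < 2 / r`.
            have h2 : n - A * σ ≤ ‖latticePoint k - z‖ := by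
              have := norm_sub_norm_le (latticePoint k) z
              linarith
            have h3 : c * ((n - A * σ) / σ) ≤ c * (‖latticePoint k - z‖ / σ) := by gcongr
            have h4 : c * ((n - A * σ) / σ) = c * (n / σ) - c * A := by field_simp
            have h5 : c / 2 / σ ≤ c / 2 * (n / σ) := by
              rw [mul_div_assoc', div_le_div_iff_of_pos_right hσ0]
              nlinarith
            have h6 : c' * n ≤ c / 2 * (n / σ) := by
              rw [hc', mul_div_assoc', le_div_iff₀ hσ0]
              rw [lt_div_iff₀ hr] at hσr
              have : 0 ≤ c * n := by positivity
              nlinarith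
            linarith
        _ = D * Real.exp (-(c' * n)) := by rw [Real.exp_add, hD]; ring
    rw [norm_mul, Real.norm_of_nonneg (hf.1 _), Real.norm_eq_abs]
    calc |(k i : ℝ)| * f (latticePoint k) ≤ n * (D * Real.exp (-(c' * n))) :=
          mul_le_mul hki hfk (hf.1 _) (by positivity)
      _ = D * (n * Real.exp (-(c' * n))) := by ring

/-! ### Dimension one: decay and summability -/

theorem IsLogConcave.comp_linearMap {E F : Type*} [AddCommGroup E] [Module ℝ E] [AddCommGroup F]
    [Module ℝ F] {f : F → ℝ} (hf : IsLogConcave f) (g : E →ₗ[ℝ] F) :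
    IsLogConcave fun x => f (g x) :=
  ⟨fun x => hf.1 _, fun x y a b ha hb hab => by
    simpa only [map_add, map_smul] using hf.2 (g x) (g y) a b ha hb hab⟩

theorem IsLogConcave.exists_exp_bound_real {f : ℝ → ℝ} (hf : IsLogConcave f) (hi : Integrable f)
    (hpos : 0 < ∫ x, f x) : ∃ A a : ℝ, 0 < A ∧ 0 < a ∧ ∀ x, f x ≤ A * Real.exp (-(a * |x|)) := by
  have hmp := volume_preserving_funUnique (Fin 1) ℝ
  have hg : IsLogConcave fun x : Fin 1 → ℝ => f (x 0) :=
    hf.comp_linearMap (LinearMap.proj (R := ℝ) (φ := fun _ : Fin 1 => ℝ) 0)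
  have hgi : Integrable fun x : Fin 1 → ℝ => f (x 0) :=
    (hmp.integrable_comp_emb (MeasurableEquiv.measurableEmbedding _)).2 hi
  have hgint : ∫ x : Fin 1 → ℝ, f (x 0) = ∫ x, f x :=
    hmp.integral_comp (MeasurableEquiv.measurableEmbedding _) f
  obtain ⟨A, a, hA, ha, h⟩ := hg.exists_exp_bound hgi (by rw [hgint]; exact hpos)
  refine ⟨A, a, hA, ha, fun x => ?_⟩
  have := h fun _ => x
  simpa using this

theorem integrable_abs_pow_mul_exp {a : ℝ} (ha : 0 < a) (n : ℕ) :
    Integrable fun x : ℝ => |x| ^ n * Real.exp (-(a * |x|)) := by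
  have h := integrable_norm_pow_mul_exp (d := 1) ha n
  have hmp := volume_preserving_funUnique (Fin 1) ℝ
  rw [← hmp.integrable_comp_emb (MeasurableEquiv.measurableEmbedding _)]
  refine h.congr (Filter.Eventually.of_forall fun x => ?_)
  have : ‖x‖ = |x 0| := by
    rw [Pi.norm_def, Finset.univ_unique, Finset.sup_singleton]
    rfl
  change ‖x‖ ^ n * Real.exp (-(a * ‖x‖)) = |x 0| ^ n * Real.exp (-(a * |x 0|))
  rw [this]

theorem IsLogConcave.integrable_id_mul {f : ℝ → ℝ} (hf : IsLogConcave f) (hi : Integrable f)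
    (hpos : 0 < ∫ x, f x) : Integrable fun x => x * f x := by
  obtain ⟨A, a, hA, ha, h⟩ := hf.exists_exp_bound_real hi hpos
  refine ((integrable_abs_pow_mul_exp ha 1).const_mul A).mono'
    (continuous_id.aestronglyMeasurable.mul hi.aestronglyMeasurable)
    (Filter.Eventually.of_forall fun x => ?_)
  rw [norm_mul, Real.norm_eq_abs, Real.norm_of_nonneg (hf.1 x), pow_one]
  calc |x| * f x ≤ |x| * (A * Real.exp (-(a * |x|))) := by gcongr; exact h x
    _ = _ := by ring

theorem map_floor_volume : Measure.map (fun x : ℝ => ⌊x⌋) volume = Measure.count := by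
  rw [Measure.ext_iff_singleton]
  intro k
  rw [Measure.map_apply Int.measurable_floor (measurableSet_singleton k), Measure.count_singleton,
    Int.preimage_floor_singleton, Real.volume_Ico]
  simp

theorem integrable_comp_floor_iff {u : ℤ → ℝ} : Integrable (fun x : ℝ => u ⌊x⌋) ↔ Summable u := by
  have h := integrable_map_measure (μ := (volume : Measure ℝ)) (f := fun x : ℝ => ⌊x⌋) (g := u)
    (Measurable.of_discrete.aestronglyMeasurable) Int.measurable_floor.aemeasurable
  rw [map_floor_volume, integrable_count_iff, summable_norm_iff] at h
  exact h.symm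

theorem integral_comp_floor {u : ℤ → ℝ} (hu : Summable u) :
    ∫ x : ℝ, u ⌊x⌋ = ∑' k, u k := by
  have h := integral_map (μ := (volume : Measure ℝ)) (φ := fun x : ℝ => ⌊x⌋) (f := u)
    Int.measurable_floor.aemeasurable (Measurable.of_discrete.aestronglyMeasurable)
  rw [← h, map_floor_volume, integral_countable (integrable_count_iff.2 hu.norm)]
  simp

theorem IsLogConcave.summable_int {f : ℝ → ℝ} (hf : IsLogConcave f) (hi : Integrable f)
    (hpos : 0 < ∫ x, f x) :
    Summable (fun k : ℤ => f k) ∧ Summable fun k : ℤ => (k : ℝ) * f k := by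
  obtain ⟨A, a, hA, ha, h⟩ := hf.exists_exp_bound_real hi hpos
  have key : ∀ u : ℤ → ℝ, (∀ k, |u k| ≤ 1 + |(k : ℝ)|) → Summable fun k : ℤ => u k * f k := by
    intro u hu
    rw [← integrable_comp_floor_iff]
    have h0 := integrable_abs_pow_mul_exp ha 0
    have h1 := integrable_abs_pow_mul_exp ha 1
    have hm : Measurable fun x : ℝ => u ⌊x⌋ * f ⌊x⌋ :=
      (Measurable.of_discrete (f := fun k : ℤ => u k * f k)).comp Int.measurable_floor
    refine (((h0.const_mul 2).add h1).const_mul (A * Real.exp a)).mono' hm.aestronglyMeasurable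
      (Filter.Eventually.of_forall fun x => ?_)
    rw [norm_mul, Real.norm_of_nonneg (hf.1 _)]
    have hx1 : |((⌊x⌋ : ℤ) : ℝ) - x| ≤ 1 := by
      rw [abs_sub_comm, abs_of_nonneg (sub_nonneg.2 (Int.floor_le x))]
      linarith [Int.lt_floor_add_one x]
    set p : ℝ := ((⌊x⌋ : ℤ) : ℝ)
    have hp1 : |p| ≤ |x| + 1 := by linarith [abs_sub_abs_le_abs_sub p x]
    have hp2 : |x| ≤ |p| + 1 := by
      have := abs_sub_abs_le_abs_sub x p
      rw [abs_sub_comm] at this; linarith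
    calc ‖u ⌊x⌋‖ * f p ≤ (1 + |p|) * (A * Real.exp (-(a * |p|))) :=
          mul_le_mul (hu _) (h p) (hf.1 _) (by positivity)
      _ ≤ (2 + |x|) * (A * Real.exp (a - a * |x|)) := by
          gcongr ?_ * (A * Real.exp ?_)
          · linarith
          · nlinarith
      _ = _ := by
          simp only [Pi.add_apply]
          rw [sub_eq_add_neg, Real.exp_add]; ring
  exact ⟨by simpa using key (fun _ => 1) fun k => by simp,
    key (fun k => k) fun k => by simp⟩

/-! ### Dimension one: a centered function is at most `e` times its value at the origin -/

/-- If `f 0 = 0`, the convex support lies on one side of `0`; then `x f(x)` has constant sign and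
zero integral, forcing `f = 0` almost everywhere. -/
theorem IsLogConcave.pos_zero_of_centered {f : ℝ → ℝ} (hf : IsLogConcave f) (hi : Integrable f)
    (hpos : 0 < ∫ x, f x) (hc : ∫ x, x * f x = 0) : 0 < f 0 := by
  by_contra! h0
  have h0 : f 0 = 0 := le_antisymm h0 (hf.1 0)
  have hxi := hf.integrable_id_mul hi hpos
  have hside : (∀ x, 0 < x → f x = 0) ∨ ∀ x, x < 0 → f x = 0 := by
    by_contra! h
    obtain ⟨⟨x, hx, hfx⟩, y, hy, hfy⟩ := h
    have hx' : 0 < f x := lt_of_le_of_ne (hf.1 x) hfx.symm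
    have hy' : 0 < f y := lt_of_le_of_ne (hf.1 y) hfy.symm
    have hseg := (hf.convex_ge (min (f x) (f y))).ordConnected.out
      (show min (f x) (f y) ≤ f y from min_le_right _ _)
      (show min (f x) (f y) ≤ f x from min_le_left _ _)
      (show (0 : ℝ) ∈ Set.Icc y x from ⟨hy.le, hx.le⟩)
    have : min (f x) (f y) ≤ f 0 := hseg
    rw [h0] at this
    exact absurd this (not_le.2 (lt_min hx' hy'))
  have hae : (fun x => x * f x) =ᵐ[volume] 0 := by
    rcases hside with h | h
    · have h2 : (fun x => -(x * f x)) =ᵐ[volume] 0 := by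
        refine (integral_eq_zero_iff_of_nonneg (fun x => ?_) hxi.neg).1 (by
          rw [integral_neg', hc, neg_zero])
        rcases le_or_gt x 0 with hx | hx
        · have := mul_nonneg (neg_nonneg.2 hx) (hf.1 x)
          simpa using this
        · simp [h x hx]
      filter_upwards [h2] with x hx
      simpa using hx
    · refine (integral_eq_zero_iff_of_nonneg (fun x => ?_) hxi).1 hc
      rcases le_or_gt 0 x with hx | hx
      · exact mul_nonneg hx (hf.1 x)
      · simp [h x hx]
  have hf0 : f =ᵐ[volume] 0 := by
    filter_upwards [hae] with x hx
    rcases mul_eq_zero.1 hx with hx | hx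
    · rw [hx, h0]; rfl
    · exact hx
  rw [integral_congr_ae hf0] at hpos
  simp at hpos

theorem integral_Iic_id_mul_exp {s a : ℝ} (hs : 0 < s) :
    IntegrableOn (fun x => x * Real.exp (s * x)) (Set.Iic a) ∧
      ∫ x in Set.Iic a, x * Real.exp (s * x) = (a / s - 1 / s ^ 2) * Real.exp (s * a) := by
  have hint : IntegrableOn (fun x => x * Real.exp (s * x)) (Set.Iic a) := by
    have h1 := (integrable_abs_pow_mul_exp hs 1).const_mul (Real.exp (2 * s * |a|))
    refine h1.integrableOn.mono' (Continuous.aestronglyMeasurable (by fun_prop)) ?_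
    refine (ae_restrict_iff' measurableSet_Iic).2 (Filter.Eventually.of_forall fun x hx => ?_)
    rw [norm_mul, Real.norm_eq_abs, Real.norm_of_nonneg (Real.exp_pos _).le, pow_one,
      mul_left_comm, ← Real.exp_add]
    gcongr
    have hx : x ≤ a := hx
    have : x + |x| ≤ 2 * |a| := by
      rcases le_total 0 x with h | h
      · rw [abs_of_nonneg h]; linarith [le_abs_self a]
      · rw [abs_of_nonpos h]; linarith [abs_nonneg a]
    nlinarith
  refine ⟨hint, ?_⟩
  have hder : ∀ x, HasDerivAt (fun x => (x / s - 1 / s ^ 2) * Real.exp (s * x))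
      (x * Real.exp (s * x)) x := by
    intro x
    have h1 : HasDerivAt (fun x => x / s - 1 / s ^ 2) (1 / s) x :=
      ((hasDerivAt_id x).div_const s).sub_const _
    have h2 : HasDerivAt (fun x => Real.exp (s * x)) (Real.exp (s * x) * (s * 1)) x :=
      ((hasDerivAt_id x).const_mul s).exp
    refine (h1.mul h2).congr_deriv ?_
    field_simp
    ring
  have ht : Filter.Tendsto (fun x => (x / s - 1 / s ^ 2) * Real.exp (s * x)) Filter.atBot
      (nhds 0) := by
    have h1 : Filter.Tendsto (fun y : ℝ => -(y ^ 1 * Real.exp (-y) + y ^ 0 * Real.exp (-y))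
        / s ^ 2) Filter.atTop (nhds (-(0 + 0) / s ^ 2)) :=
      (((Real.tendsto_pow_mul_exp_neg_atTop_nhds_zero 1).add
        (Real.tendsto_pow_mul_exp_neg_atTop_nhds_zero 0)).neg).div_const _
    have h2 : Filter.Tendsto (fun x : ℝ => -(s * x)) Filter.atBot Filter.atTop :=
      Filter.tendsto_neg_atBot_atTop.comp (Filter.tendsto_id.const_mul_atBot hs)
    have h3 := h1.comp h2
    rw [add_zero, neg_zero, zero_div] at h3
    refine h3.congr fun x => ?_
    simp only [Function.comp, neg_neg]
    field_simp
    ring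
  rw [integral_Iic_of_hasDerivAt_of_tendsto (hder a).continuousAt.continuousWithinAt
    (fun x _ => hder x) hint ht, sub_zero]

/-- Let `f(0) exp (s x)` agree with `f` at `0` and `x₁`. Log-concavity puts `f` above it on `[0,
x₁]` and below it for `x < 0`, so `x f(x)` dominates `f(0) x exp (s x)` on `(-∞, x₁]`. With `l = s
x₁ > 1` the latter has positive integral, proportional to `(l - 1) / s ^ 2`, against centering. -/
theorem IsLogConcave.le_exp_one_mul_zero_of_pos {f : ℝ → ℝ} (hf : IsLogConcave f)
    (hi : Integrable f) (hpos : 0 < ∫ x, f x) (hc : ∫ x, x * f x = 0) {x₁ : ℝ} (hx₁ : 0 < x₁) :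
    f x₁ ≤ Real.exp 1 * f 0 := by
  have h0 := hf.pos_zero_of_centered hi hpos hc
  have hxi := hf.integrable_id_mul hi hpos
  by_contra! hlt
  have hf1 : 0 < f x₁ := lt_trans (by positivity) hlt
  set l := Real.log (f x₁ / f 0) with hl
  have hfl : f 0 * Real.exp l = f x₁ := by
    rw [hl, Real.exp_log (by positivity)]; field_simp
  have hl1 : 1 < l := by
    rw [← Real.exp_lt_exp]
    rw [← hfl, mul_comm] at hlt
    exact lt_of_mul_lt_mul_left hlt h0.le
  set s := l / x₁ with hs
  have hs0 : 0 < s := by positivity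
  have hsx : s * x₁ = l := by rw [hs]; field_simp
  have hpt : ∀ x ∈ Set.Iic x₁, f 0 * (x * Real.exp (s * x)) ≤ x * f x := by
    intro x hx
    have hx : x ≤ x₁ := hx
    rcases le_or_gt 0 x with hx0 | hx0
    · have h1 := hf.mul_exp_le (x := 0) (y := x₁) (s := 0) (t := l) (p := x / x₁) h0 (by positivity)
        (by rwa [div_le_one hx₁]) (by simp) hfl.le
      have h2 : (1 - x / x₁) • (0 : ℝ) + (x / x₁) • x₁ = x := by
        simp only [smul_eq_mul]; field_simp; ring
      have h3 : (1 - x / x₁) * 0 + x / x₁ * l = s * x := by rw [hs]; ring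
      rw [h2, h3] at h1
      calc f 0 * (x * Real.exp (s * x)) = x * (f 0 * Real.exp (s * x)) := by ring
        _ ≤ x * f x := by gcongr
    · have h1 : f x ≤ f 0 * Real.exp (s * x) := by
        by_contra! h
        obtain ⟨t, hst, ht⟩ : ∃ t, s * x < t ∧ f 0 * Real.exp t ≤ f x := by
          refine ⟨Real.log (f x / f 0), ?_, ?_⟩
          · rw [Real.lt_log_iff_exp_lt (div_pos (lt_trans (by positivity) h) h0),
              lt_div_iff₀ h0, mul_comm]
            exact h
          · rw [Real.exp_log (div_pos (lt_trans (by positivity) h) h0)]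
            apply le_of_eq; field_simp
        have hd : 0 < x₁ - x := by linarith
        have h2 := hf.mul_exp_le (x := x) (y := x₁) (s := t) (t := l) (p := -x / (x₁ - x)) h0
          (div_nonneg (by linarith) hd.le) (by rw [div_le_one hd]; linarith) ht hfl.le
        have h3 : (1 - -x / (x₁ - x)) • x + (-x / (x₁ - x)) • x₁ = 0 := by
          simp only [smul_eq_mul]; field_simp; ring
        rw [h3] at h2
        have h4 : 0 < (1 - -x / (x₁ - x)) * t + -x / (x₁ - x) * l := by
          have h5 : (1 - -x / (x₁ - x)) * t + -x / (x₁ - x) * l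
              = x₁ * (t - s * x) / (x₁ - x) := by
            rw [← hsx]; field_simp; ring
          rw [h5]
          exact div_pos (mul_pos hx₁ (by linarith)) hd
        have h6 := Real.one_lt_exp_iff.2 h4
        nlinarith
      have := mul_le_mul_of_nonpos_left h1 hx0.le
      linarith
  obtain ⟨he, heq⟩ := integral_Iic_id_mul_exp (a := x₁) hs0
  have h1 : f 0 * ((x₁ / s - 1 / s ^ 2) * Real.exp (s * x₁)) ≤ ∫ x in Set.Iic x₁, x * f x := by
    rw [← heq, ← integral_const_mul]
    exact setIntegral_mono_on (he.const_mul _) hxi.integrableOn measurableSet_Iic hpt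
  have h2 : ∫ x in Set.Iic x₁, x * f x ≤ ∫ x, x * f x := by
    rw [← integral_add_compl measurableSet_Iic hxi]
    refine le_add_of_nonneg_right (setIntegral_nonneg measurableSet_Iic.compl fun x hx => ?_)
    have hx : x₁ < x := by simpa using hx
    exact mul_nonneg (by linarith) (hf.1 x)
  have h3 : 0 < x₁ / s - 1 / s ^ 2 := by
    have : x₁ / s - 1 / s ^ 2 = (l - 1) / s ^ 2 := by rw [← hsx]; field_simp
    rw [this]
    exact div_pos (by linarith) (by positivity)
  have h4 : 0 < f 0 * ((x₁ / s - 1 / s ^ 2) * Real.exp (s * x₁)) := by positivity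
  linarith

theorem integral_id_mul_comp_neg (f : ℝ → ℝ) : ∫ x, x * f (-x) = -∫ x, x * f x := by
  rw [← integral_neg_eq_self, ← integral_neg]
  simp

theorem IsLogConcave.comp_neg {f : ℝ → ℝ} (hf : IsLogConcave f) : IsLogConcave fun x => f (-x) :=
  hf.comp_linearMap (-LinearMap.id)

theorem IsLogConcave.le_exp_one_mul_zero {f : ℝ → ℝ} (hf : IsLogConcave f)
    (hi : Integrable f) (hpos : 0 < ∫ x, f x) (hc : ∫ x, x * f x = 0) (x : ℝ) :
    f x ≤ Real.exp 1 * f 0 := by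
  rcases lt_trichotomy x 0 with hx | rfl | hx
  · have := hf.comp_neg.le_exp_one_mul_zero_of_pos hi.comp_neg
      (by rwa [integral_neg_eq_self]) (by rw [integral_id_mul_comp_neg, hc, neg_zero])
      (neg_pos.2 hx)
    simpa using this
  · exact le_mul_of_one_le_left (hf.1 0) (Real.one_le_exp zero_le_one)
  · exact hf.le_exp_one_mul_zero_of_pos hi hpos hc hx

/-! ### Dimension one: unimodality and comparison on unit cells -/

theorem IsLogConcave.min_le {f : ℝ → ℝ} (hf : IsLogConcave f) {x y z : ℝ} (hxy : x ≤ y)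
    (hyz : y ≤ z) : min (f x) (f z) ≤ f y :=
  (hf.convex_ge (min (f x) (f z))).ordConnected.out
    (show min (f x) (f z) ≤ f x from min_le_left _ _)
    (show min (f x) (f z) ≤ f z from min_le_right _ _) ⟨hxy, hyz⟩

/-- Once `f` has strictly dropped, any later rise would violate `min_le`. -/
theorem IsLogConcave.antitoneOn_Ici_of_not_monotoneOn_Iic {f : ℝ → ℝ} (hf : IsLogConcave f) {a : ℝ}
    (h : ¬MonotoneOn f (Set.Iic a)) : AntitoneOn f (Set.Ici a) := by
  simp only [MonotoneOn, not_forall, not_le] at h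
  obtain ⟨x, -, y, hy, hxy, hlt⟩ := h
  intro s hs t ht hst
  have hys : y ≤ s := le_trans hy hs
  have h1 : f s ≤ f y := by
    by_contra! hc
    exact (lt_min hlt hc).not_ge (hf.min_le hxy hys)
  by_contra! hc
  exact (lt_min (h1.trans_lt hlt) hc).not_ge (hf.min_le (hxy.trans hys) hst)

/-- Summability prevents `f N ≥ f 0` for all `N`, so monotonicity fails on a first half-line, ending
at `n + 1`. Nothing is claimed inside the cell `[n, n + 1]`, which is treated separately later. -/
theorem IsLogConcave.exists_nat_monotoneOn_antitoneOn {f : ℝ → ℝ} (hf : IsLogConcave f)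
    (hs : Summable fun k : ℤ => f k) (h0 : 0 < f 0) (hmono : MonotoneOn f (Set.Iic 0)) :
    ∃ n : ℕ, MonotoneOn f (Set.Iic (n : ℝ)) ∧ AntitoneOn f (Set.Ici ((n : ℝ) + 1)) := by
  classical
  have hex : ∃ N : ℕ, ¬MonotoneOn f (Set.Iic (N : ℝ)) := by
    by_contra! h
    have ht : Filter.Tendsto (fun N : ℕ => f N) Filter.atTop (nhds 0) := by
      have := (hs.comp_injective (i := ((↑) : ℕ → ℤ)) Nat.cast_injective).tendsto_atTop_zero
      simpa [Function.comp_def] using this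
    refine h0.not_ge (ge_of_tendsto ht (Filter.Eventually.of_forall fun N => ?_))
    exact h N (show (0 : ℝ) ≤ N by positivity) (le_refl (N : ℝ)) (by positivity)
  obtain ⟨n, hn⟩ : ∃ n, Nat.find hex = n + 1 := by
    refine Nat.exists_eq_succ_of_ne_zero fun h => ?_
    have := Nat.find_spec hex
    rw [h] at this
    exact this (by simpa using hmono)
  refine ⟨n, not_not.1 (Nat.find_min hex (by omega)), ?_⟩
  have := Nat.find_spec hex
  rw [hn] at this
  have := hf.antitoneOn_Ici_of_not_monotoneOn_Iic this
  simpa using this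

theorem hasSum_of_eq_off_range {u v : ℤ → ℝ} (hv : Summable v) (n : ℕ)
    (h : ∀ k : ℤ, (k < 0 ∨ (n : ℤ) < k) → u k = v k) :
    HasSum u ((∑' k, v k) + ∑ j ∈ Finset.range (n + 1), (u j - v j)) := by
  have h1 : HasSum (fun k => u k - v k)
      (∑ k ∈ (Finset.range (n + 1)).map Nat.castEmbedding, (u k - v k)) := by
    refine hasSum_sum_of_ne_finset_zero fun k hk => ?_
    rw [sub_eq_zero]
    refine h k ?_
    by_contra! hc
    refine hk (Finset.mem_map.2 ⟨k.toNat, Finset.mem_range.2 (by omega), ?_⟩)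
    simp [hc.1]
  rw [Finset.sum_map] at h1
  have := hv.hasSum.add h1
  simpa using this

theorem integral_le_of_floor {g : ℝ → ℝ} (hg : Integrable g) {u : ℤ → ℝ} {s : ℝ} (hu : HasSum u s)
    (h : ∀ (k : ℤ) (x : ℝ), k ≤ x → x < k + 1 → g x ≤ u k) : ∫ x, g x ≤ s := by
  rw [← hu.tsum_eq, ← integral_comp_floor hu.summable]
  exact integral_mono hg (integrable_comp_floor_iff.2 hu.summable) fun x =>
    h ⌊x⌋ x (Int.floor_le x) (Int.lt_floor_add_one x)

theorem abs_tsum_int_mul_le_of_monotoneOn {f : ℝ → ℝ} (hf : IsLogConcave f) (hi : Integrable f)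
    (hpos : 0 < ∫ x, f x) (hc : ∫ x, x * f x = 0) (hmono : MonotoneOn f (Set.Iic 0)) :
    |∑' k : ℤ, (k : ℝ) * f k| ≤ (Real.exp 1 + 1) * ∑' k : ℤ, f k := by
  have h0 := hf.pos_zero_of_centered hi hpos hc
  have hxi := hf.integrable_id_mul hi hpos
  obtain ⟨hs, hks⟩ := hf.summable_int hi hpos
  obtain ⟨n, hn, hn'⟩ := hf.exists_nat_monotoneOn_antitoneOn hs h0 hmono
  set M := Real.exp 1 * f 0 with hM
  have hfM : ∀ x, f x ≤ M := hf.le_exp_one_mul_zero hi hpos hc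
  set S := ∑' k : ℤ, f k with hS
  set T := ∑' k : ℤ, (k : ℝ) * f k with hT
  have hn1 : ∀ x y : ℝ, x ≤ y → y ≤ n → f x ≤ f y := fun x y hxy hy => hn (hxy.trans hy) hy hxy
  have hn2 : ∀ x y : ℝ, x ≤ y → (n : ℝ) + 1 ≤ x → f y ≤ f x :=
    fun x y hxy hx => hn' hx (hx.trans hxy) hxy
  -- The `n + 1` points `0, …, n` each contribute at least `f 0` to `S`.
  have hnS : (n + 1) * M ≤ Real.exp 1 * S := by
    have h1 : ∑ k ∈ (Finset.range (n + 1)).map Nat.castEmbedding, f ((k : ℤ) : ℝ) ≤ S :=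
      hs.sum_le_tsum _ fun k _ => hf.1 _
    rw [Finset.sum_map] at h1
    have h2 : ∑ _j ∈ Finset.range (n + 1), f 0 ≤
        ∑ j ∈ Finset.range (n + 1), f ((Nat.castEmbedding j : ℤ) : ℝ) := by
      refine Finset.sum_le_sum fun j hj => hn1 _ _ (by simp) ?_
      rw [Finset.mem_range] at hj
      simpa using Nat.lt_succ_iff.1 hj
    rw [Finset.sum_const, Finset.card_range, nsmul_eq_mul] at h2
    push_cast at h2
    calc (n + 1) * M = Real.exp 1 * ((n + 1) * f 0) := by rw [hM]; ring
      _ ≤ Real.exp 1 * S := by gcongr; exact h2.trans h1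
  -- upper bound for the integral
  have hup : 0 ≤ T + S + (n + 1) * M := by
    set v : ℤ → ℝ := fun k => ((k : ℝ) + 1) * f k with hv
    have hvs : HasSum v (T + S) := by
      have := hks.hasSum.add hs.hasSum
      simpa only [hv, add_mul, one_mul] using this
    -- Majorant of `x f(x)` on the cell `[k, k + 1)`: outside `0, …, n` it is `(k + 1) f(k)`, on
    -- increasing cells the right-end value, and on the mode cell the global bound `M`.
    set u : ℤ → ℝ := fun k => if k < 0 ∨ (n : ℤ) < k then v k else
      if k < n then ((k : ℝ) + 1) * f (k + 1) else (n + 1) * M with hu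
    have hus := hasSum_of_eq_off_range hvs.summable n (u := u) fun k hk => by
      simp only [hu, if_pos hk]
    have hle := integral_le_of_floor hxi hus fun k x hkx hxk => by
      simp only [hu]
      split_ifs with h1 h2
      · rcases h1 with h1 | h1
        · have h3 : (k : ℝ) + 1 ≤ 0 := by exact_mod_cast h1
          have h4 : f k ≤ f x := hn1 _ _ hkx (by linarith [Nat.cast_nonneg (α := ℝ) n])
          calc x * f x ≤ (k + 1) * f x := mul_le_mul_of_nonneg_right hxk.le (hf.1 x)
            _ ≤ (k + 1) * f k := mul_le_mul_of_nonpos_left h4 h3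
        · have h3 : (n : ℝ) + 1 ≤ k := by exact_mod_cast h1
          have hn0 := Nat.cast_nonneg (α := ℝ) n
          exact mul_le_mul hxk.le (hn2 _ _ hkx h3) (hf.1 x) (by linarith)
      · have h3 : (0 : ℝ) ≤ k := by exact_mod_cast not_lt.1 fun h => h1 (Or.inl h)
        have h4 : (k : ℝ) + 1 ≤ n := by exact_mod_cast h2
        exact mul_le_mul hxk.le (hn1 _ _ hxk.le h4) (hf.1 x) (by linarith)
      · have h3 : (k : ℝ) ≤ n := by exact_mod_cast not_lt.1 fun h => h1 (Or.inr h)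
        exact mul_le_mul (by linarith) (hfM x) (hf.1 x) (by positivity)
    rw [hc, hvs.tsum_eq, Finset.sum_range_succ] at hle
    have e1 : ∀ j ∈ Finset.range n, u j - v j = ((j : ℝ) + 1) * (f (j + 1) - f j) := by
      intro j hj
      rw [Finset.mem_range] at hj
      have h1 : ¬((j : ℤ) < 0 ∨ (n : ℤ) < j) := by omega
      have h2 : (j : ℤ) < n := by omega
      simp only [hu, hv, if_neg h1, if_pos h2, Int.cast_natCast]
      ring
    have e2 : u n - v n = (n + 1) * (M - f n) := by
      have h1 : ¬((n : ℤ) < 0 ∨ (n : ℤ) < n) := by omega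
      simp only [hu, hv, if_neg h1, lt_irrefl, if_false, Int.cast_natCast]
      ring
    rw [Finset.sum_congr rfl e1, e2] at hle
    -- Summation by parts: all the corrections from increasing cells together cost at most `n f(n)`,
    -- which the mode cell then cancels.
    have e3 : ∀ N : ℕ, ∑ j ∈ Finset.range N, ((j : ℝ) + 1) * (f (j + 1) - f j) ≤ N * f N := by
      intro N
      induction N with
      | zero => simp
      | succ N ih =>
        rw [Finset.sum_range_succ]
        push_cast
        linarith [hf.1 N]
    have := e3 n
    have := hf.1 n
    linarith
  -- lower bound for the integral
  have hlow : T - S - n * M ≤ 0 := by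
    -- Reindexing `k + 1 ↦ k` makes this sum to `T - S`.
    set v : ℤ → ℝ := fun k => (k : ℝ) * f (k + 1) with hv
    have hvs : HasSum v (T - S) := by
      have h1 := hks.hasSum.sub hs.hasSum
      have h2 := (Equiv.addRight (1 : ℤ)).hasSum_iff.2 h1
      refine h2.congr_fun fun k => ?_
      simp only [hv, Function.comp, Equiv.coe_addRight]
      push_cast
      ring
    set u : ℤ → ℝ := fun k => if k < 0 ∨ (n : ℤ) < k then v k else
      if k < n then (k : ℝ) * f k else n * min (f n) (f (n + 1)) with hu
    have hus := hasSum_of_eq_off_range hvs.summable n (u := u) fun k hk => by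
      simp only [hu, if_pos hk]
    have hle := integral_le_of_floor hxi.neg hus.neg fun k x hkx hxk => by
      simp only [hu, Pi.neg_apply]
      rw [neg_le_neg_iff]
      have hn0 := Nat.cast_nonneg (α := ℝ) n
      split_ifs with h1 h2
      · rcases h1 with h1 | h1
        · have h3 : (k : ℝ) + 1 ≤ 0 := by exact_mod_cast h1
          have h4 : f x ≤ f (k + 1) := hn1 _ _ hxk.le (by linarith)
          calc k * f (k + 1) ≤ k * f x := mul_le_mul_of_nonpos_left h4 (by linarith)
            _ ≤ x * f x := mul_le_mul_of_nonneg_right hkx (hf.1 x)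
        · have h3 : (n : ℝ) + 1 ≤ k := by exact_mod_cast h1
          exact mul_le_mul hkx (hn2 _ _ hxk.le (by linarith)) (hf.1 _) (by linarith)
      · have h3 : (0 : ℝ) ≤ k := by exact_mod_cast not_lt.1 fun h => h1 (Or.inl h)
        have h4 : (k : ℝ) + 1 ≤ n := by exact_mod_cast h2
        exact mul_le_mul hkx (hn1 _ _ hkx (by linarith)) (hf.1 _) (by linarith)
      · have hkn : k = n := by omega
        rw [hkn, Int.cast_natCast] at hkx hxk
        exact mul_le_mul hkx (hf.min_le hkx hxk.le) (le_min (hf.1 _) (hf.1 _)) (by linarith)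
    rw [integral_neg', hc, neg_zero, hvs.tsum_eq, Finset.sum_range_succ] at hle
    have e1 : ∀ j ∈ Finset.range n, u j - v j = -((j : ℝ) * (f (j + 1) - f j)) := by
      intro j hj
      rw [Finset.mem_range] at hj
      have h1 : ¬((j : ℤ) < 0 ∨ (n : ℤ) < j) := by omega
      have h2 : (j : ℤ) < n := by omega
      simp only [hu, hv, if_neg h1, if_pos h2, Int.cast_natCast]
      ring
    have e2 : u n - v n = n * (min (f n) (f (n + 1)) - f (n + 1)) := by
      have h1 : ¬((n : ℤ) < 0 ∨ (n : ℤ) < n) := by omega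
      simp only [hu, hv, if_neg h1, lt_irrefl, if_false, Int.cast_natCast]
      ring
    rw [Finset.sum_congr rfl e1, e2, Finset.sum_neg_distrib] at hle
    have e3 : ∀ N : ℕ, ∑ j ∈ Finset.range N, (j : ℝ) * (f (j + 1) - f j) ≤ N * f N := by
      intro N
      induction N with
      | zero => simp
      | succ N ih =>
        rw [Finset.sum_range_succ]
        push_cast
        linarith [hf.1 (N + 1)]
    -- The bracket is the maximum of the two values.
    have e4 : (n : ℝ) * (f n + f (n + 1) - min (f n) (f (n + 1))) ≤ n * M := by
      gcongr
      rcases min_choice (f n) (f (n + 1)) with h | h <;> rw [h]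
      · linarith [hfM (n + 1)]
      · linarith [hfM n]
    have := e3 n
    linarith
  have hM0 : 0 ≤ M := by positivity
  rw [abs_le]
  constructor <;> linarith

/-- If `f` is not monotone on `(-∞, 0]`, it is antitone on `[0, ∞)`, and its reflection falls under
the monotone case. -/
theorem abs_tsum_int_mul_le {f : ℝ → ℝ} (hf : IsLogConcave f) (hi : Integrable f)
    (hpos : 0 < ∫ x, f x) (hc : ∫ x, x * f x = 0) :
    |∑' k : ℤ, (k : ℝ) * f k| ≤ (Real.exp 1 + 1) * ∑' k : ℤ, f k := by
  by_cases hmono : MonotoneOn f (Set.Iic 0)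
  · exact abs_tsum_int_mul_le_of_monotoneOn hf hi hpos hc hmono
  have hanti := hf.antitoneOn_Ici_of_not_monotoneOn_Iic hmono
  have h := abs_tsum_int_mul_le_of_monotoneOn hf.comp_neg hi.comp_neg
    (by rwa [integral_neg_eq_self]) (by rw [integral_id_mul_comp_neg, hc, neg_zero])
    fun x hx y hy hxy => hanti (Set.mem_Ici.2 (neg_nonneg.2 hy)) (Set.mem_Ici.2 (neg_nonneg.2 hx))
      (neg_le_neg hxy)
  have e1 : ∑' k : ℤ, f (-(k : ℝ)) = ∑' k : ℤ, f k := by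
    rw [← (Equiv.neg ℤ).tsum_eq fun k : ℤ => f k]
    simp
  have e2 : ∑' k : ℤ, (k : ℝ) * f (-(k : ℝ)) = -∑' k : ℤ, (k : ℝ) * f k := by
    rw [← (Equiv.neg ℤ).tsum_eq fun k : ℤ => (k : ℝ) * f k, ← tsum_neg]
    simp
  rwa [e1, e2, abs_neg] at h

theorem mainTheorem7 :
    (∀ d : ℕ, ∃ C : ℝ, ∀ f : (Fin d → ℝ) → ℝ,
      IsLogConcave f → IsDensity f → IsCentered f → IsIsotropic f →
        ∀ i : Fin d,
          Integrable (fun x : Fin d → ℝ => x i * f x) ∧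
          Summable (fun k : Fin d → ℤ => (k i : ℝ) * f (latticePoint k)) ∧
          |(∑' k : Fin d → ℤ, (k i : ℝ) * f (latticePoint k)) - ∫ x, x i * f x| ≤ C ∧
          |∑' k : Fin d → ℤ, (k i : ℝ) * f (latticePoint k)| ≤ C) ∧
    (∀ f : ℝ → ℝ, IsLogConcave f → Integrable f → 0 < ∫ x, f x → (∫ x, x * f x) = 0 →
      Integrable (fun x : ℝ => x * f x) ∧
      Summable (fun k : ℤ => f k) ∧
      Summable (fun k : ℤ => (k : ℝ) * f k) ∧
      |(∫ x, x * f x) - ∑' k : ℤ, (k : ℝ) * f k| ≤ (Real.exp 1 + 1) * ∑' k : ℤ, f k) := by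
  constructor
  · intro d
    rcases Nat.eq_zero_or_pos d with rfl | hd
    · exact ⟨0, fun f _ _ _ _ i => i.elim0⟩
    have : NeZero d := ⟨hd.ne'⟩
    obtain ⟨C, hC⟩ := isotropic_lattice_sum_bound d
    refine ⟨C, fun f hf hdens hc hiso i => ?_⟩
    have hpos : 0 < ∫ x, f x := by rw [hdens.2.2]; exact one_pos
    refine ⟨hf.integrable_coord_mul hdens.2.1 hpos i, ?_, ?_, hC f hf hdens hc hiso i⟩
    · refine summable_of_integrable_comp_latticeFloor
        (u := fun k => (k i : ℝ) * f (latticePoint k)) ?_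
      exact hf.integrable_latticeFloor hdens.2.1 hpos (w := fun x => x i) fun x => by
        have : |x i| ≤ ‖x‖ := norm_le_pi_norm x i
        linarith
    · rw [hc i, sub_zero]
      exact hC f hf hdens hc hiso i
  · intro f hf hi hpos hc
    obtain ⟨hs, hks⟩ := hf.summable_int hi hpos
    refine ⟨hf.integrable_id_mul hi hpos, hs, hks, ?_⟩
    rw [hc, zero_sub, abs_neg]
    exact abs_tsum_int_mul_le hf hi hpos hc
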